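/- Let $a<\xi_1<\xi_2<b$, let $\rho_1,\rho_2,\rho_3>0$, let $p,q,r\in L_2([a,b];\mathbb{R})$, and let $\alpha_1,\dots,\alpha_6,\alpha_1',\alpha_2',\gamma_1,\gamma_2,\gamma_1',\gamma_2'$ be real with $\alpha_3,\alpha_5>0$, $d_1:=\alpha_1\alpha_2'-\alpha_1'\alpha_2>0$ and $d_2:=\gamma_1\gamma_2'-\gamma_1'\gamma_2>0$. Let $\rho(x)=\rho_1^{-1},\rho_2^{-1},\rho_3^{-1}$ on $[a,\xi_1)$, $(\xi_1,\xi_2)$, $(\xi_2,b]$ respectively. For $\lambda\in\mathbb{C}$ consider, for $y=(y_1,y_2)^T$ absolutely continuous on each of the three intervals (up to the end points), the Dirac system $$\rho(x)\begin{pmatrix}0&1\\-1&0\end{pmatrix}y'+\begin{pmatrix}p&q\\q&r\end{pmatrix}y=\lambda y\quad\text{a.e.}\tag{1}$$ with the transmission conditions $$y_1(\xi_1+0)=\alpha_3y_1(\xi_1-0),\quad y_2(\xi_1+0)=(\alpha_4+\lambda)y_1(\xi_1-0)+\alpha_3^{-1}y_2(\xi_1-0),$$ $$y_1(\xi_2+0)=\alpha_5y_1(\xi_2-0),\quad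 y_2(\xi_2+0)=(\alpha_6+\lambda)y_1(\xi_2-0)+\alpha_5^{-1}y_2(\xi_2-0)\tag{2}$$ and the boundary conditions $$\lambda(\alpha_1'y_1(a)-\alpha_2'y_2(a))-(\alpha_1y_1(a)-\alpha_2y_2(a))=0,\quad \lambda(\gamma_1'y_1(b)-\gamma_2'y_2(b))+(\gamma_1y_1(b)-\gamma_2y_2(b))=0.\tag{3}$$ An eigenvalue is a $\lambda\in\mathbb{C}$ for which (1)--(3) has a nontrivial solution. Let $\varphi(\cdot,\lambda)$ and $\psi(\cdot,\lambda)$ be the solutions of (1), (2) with $\varphi(a,\lambda)=(\lambda\alpha_2'-\alpha_2,\ \lambda\alpha_1'-\alpha_1)^T$ and $\psi(b,\lambda)=(\lambda\gamma_2'+\gamma_2,\ \lambda\gamma_1'+\gamma_1)^T$. Put $\Delta(\lambda)=\varphi_1(b,\lambda)\psi_2(b,\lambda)-\varphi_2(b,\lambda)\psi_1(b,\lambda)$, define the Weyl function by $$M(\lambda)=\frac{\alpha_1'\psi_1(a,\lambda)-\alpha_2'\psi_2(a,\lambda)}{d_1\Delta(\lambda)},$$ and for an eigenvalue $\lambda_n$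 the normalizing constant by $$\mu_n=\int_a^b\rho(x)^{-1}\bigl[\varphi_1^2+\varphi_2^2\bigr](x,\lambda_n)\,dx+\alpha_3\varphi_1^2(\xi_1-0,\lambda_n)+\alpha_5\varphi_1^2(\xi_2-0,\lambda_n)$$ $$\qquad+\tfrac1{d_1}\bigl(\alpha_1'\varphi_1(a,\lambda_n)-\alpha_2'\varphi_2(a,\lambda_n)\bigr)^2+\tfrac1{d_2}\bigl(\gamma_1'\varphi_1(b,\lambda_n)-\gamma_2'\varphi_2(b,\lambda_n)\bigr)^2.$$ Then the eigenvalues can be listed as $(\lambda_n)_{n\in\mathbb{Z}}$ without repetition, and for every such listing $\mu_n\neq0$ for all $n$, and for every $\lambda\in\mathbb{C}$ that is not an eigenvalue, $\Delta(\lambda)\neq0$ and $$M(\lambda)=\sum_{n=-\infty}^{\infty}\frac{1}{\mu_n(\lambda_n-\lambda)},$$ the series converging unconditionally (equivalently, absolutely). -/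

import Mathlib

open MeasureTheory Set

/-- The data of the boundary value problem `L`: an interval `[a, b]` with two interior
points `ξ₁ < ξ₂`, positive weights `ρ₁, ρ₂, ρ₃`, a real symmetric square integrable potential
`Ω = [[p, q], [q, r]]`, and the real coefficients of the boundary and transmission conditions. -/
structure DiracProblem where
  (a ξ₁ ξ₂ b : ℝ)
  (ρ₁ ρ₂ ρ₃ : ℝ)
  (p q r : ℝ → ℝ)
  (α₁ α₂ α₃ α₄ α₅ α₆ α₁' α₂' γ₁ γ₂ γ₁' γ₂' : ℝ)
  a_lt : a < ξ₁
  ξ_lt : ξ₁ < ξ₂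
  lt_b : ξ₂ < b
  ρ₁_pos : 0 < ρ₁
  ρ₂_pos : 0 < ρ₂
  ρ₃_pos : 0 < ρ₃
  p_memLp : MemLp p 2 (volume.restrict (Icc a b))
  q_memLp : MemLp q 2 (volume.restrict (Icc a b))
  r_memLp : MemLp r 2 (volume.restrict (Icc a b))
  α₃_pos : 0 < α₃
  α₅_pos : 0 < α₅
  /-- positivity of `d₁`, the determinant of `[[α₁, α₁'], [α₂, α₂']]` -/
  d₁_pos : 0 < α₁ * α₂' - α₁' * α₂
  /-- positivity of `d₂`, the determinant of `[[γ₁, γ₁'], [γ₂, γ₂']]` -/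
  d₂_pos : 0 < γ₁ * γ₂' - γ₁' * γ₂

/-- A two-component function on `[a, ξ₁) ∪ (ξ₁, ξ₂) ∪ (ξ₂, b]`, given by its three pieces. Each
piece is evaluated on the closed interval, where its value at an interior point `ξ₁` or `ξ₂` is the
one-sided limit there: `y.left ξ₁ = y(ξ₁ - 0)`, `y.mid ξ₁ = y(ξ₁ + 0)`, `y.mid ξ₂ = y(ξ₂ - 0)`,
`y.right ξ₂ = y(ξ₂ + 0)`. (Solutions are continuous on each closed interval.) -/
structure PiecewiseFun where
  (left mid right : ℝ → ℂ × ℂ)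

instance : Nonempty PiecewiseFun := ⟨⟨0, 0, 0⟩⟩

/-- The Wronskian `y₁ z₂ - y₂ z₁` of two vectors. -/
def wronskian (y z : ℂ × ℂ) : ℂ := y.1 * z.2 - y.2 * z.1

namespace DiracProblem

variable (P : DiracProblem)

/-- `d₁`, the determinant of `[[α₁, α₁'], [α₂, α₂']]`. -/
def d₁ : ℝ := P.α₁ * P.α₂' - P.α₁' * P.α₂

/-- `d₂`, the determinant of `[[γ₁, γ₁'], [γ₂, γ₂']]`. -/
def d₂ : ℝ := P.γ₁ * P.γ₂' - P.γ₁' * P.γ₂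

/-- `y` is an absolutely continuous solution of `ρ⁻¹ B y' + Ω y = lam y` on `[c, d]`, where
`B = [[0, 1], [-1, 0]]`; the equation holds almost everywhere. -/
def SolvesOn (ρ c d : ℝ) (lam : ℂ) (y : ℝ → ℂ × ℂ) : Prop :=
  AbsolutelyContinuousOnInterval (fun x => (y x).1) c d ∧
  AbsolutelyContinuousOnInterval (fun x => (y x).2) c d ∧
  ∀ᵐ x ∂(volume.restrict (Icc c d)), ∃ y₁' y₂' : ℂ,
    HasDerivAt (fun t => (y t).1) y₁' x ∧
    HasDerivAt (fun t => (y t).2) y₂' x ∧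
    (ρ : ℂ)⁻¹ * y₂' + (P.p x * (y x).1 + P.q x * (y x).2) = lam * (y x).1 ∧
    -(ρ : ℂ)⁻¹ * y₁' + (P.q x * (y x).1 + P.r x * (y x).2) = lam * (y x).2

/-- The differential equation on the three subintervals. -/
def SolvesEq (lam : ℂ) (y : PiecewiseFun) : Prop :=
  P.SolvesOn P.ρ₁ P.a P.ξ₁ lam y.left ∧
  P.SolvesOn P.ρ₂ P.ξ₁ P.ξ₂ lam y.mid ∧
  P.SolvesOn P.ρ₃ P.ξ₂ P.b lam y.right

/-- The four transmission conditions at `ξ₁` and `ξ₂`. -/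
def Transmission (lam : ℂ) (y : PiecewiseFun) : Prop :=
  (y.mid P.ξ₁).1 - P.α₃ * (y.left P.ξ₁).1 = 0 ∧
  (y.mid P.ξ₁).2 - (P.α₄ + lam) * (y.left P.ξ₁).1 - (P.α₃ : ℂ)⁻¹ * (y.left P.ξ₁).2 = 0 ∧
  (y.right P.ξ₂).1 - P.α₅ * (y.mid P.ξ₂).1 = 0 ∧
  (y.right P.ξ₂).2 - (P.α₆ + lam) * (y.mid P.ξ₂).1 - (P.α₅ : ℂ)⁻¹ * (y.mid P.ξ₂).2 = 0

/-- The boundary condition at `a`. -/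
def BoundaryLeft (lam : ℂ) (y : PiecewiseFun) : Prop :=
  lam * (P.α₁' * (y.left P.a).1 - P.α₂' * (y.left P.a).2)
    - (P.α₁ * (y.left P.a).1 - P.α₂ * (y.left P.a).2) = 0

/-- The boundary condition at `b`. -/
def BoundaryRight (lam : ℂ) (y : PiecewiseFun) : Prop :=
  lam * (P.γ₁' * (y.right P.b).1 - P.γ₂' * (y.right P.b).2)
    + (P.γ₁ * (y.right P.b).1 - P.γ₂ * (y.right P.b).2) = 0

/-- `y` does not vanish identically on `[a, ξ₁) ∪ (ξ₁, ξ₂) ∪ (ξ₂, b]`. -/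
def Nontrivial (y : PiecewiseFun) : Prop :=
  (∃ x ∈ Ico P.a P.ξ₁, y.left x ≠ 0) ∨ (∃ x ∈ Ioo P.ξ₁ P.ξ₂, y.mid x ≠ 0) ∨
    (∃ x ∈ Ioc P.ξ₂ P.b, y.right x ≠ 0)

/-- The eigenvalues of the problem: those `lam` for which the boundary value problem has a
nontrivial solution. -/
def eigenvalues : Set ℂ :=
  {lam | ∃ y : PiecewiseFun, P.SolvesEq lam y ∧ P.BoundaryLeft lam y ∧ P.BoundaryRight lam y ∧
    P.Transmission lam y ∧ P.Nontrivial y}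

/-- The initial value problem (at `a`) that defines `φ(·, lam)`. -/
def IsPhi (lam : ℂ) (y : PiecewiseFun) : Prop :=
  P.SolvesEq lam y ∧
  y.left P.a = (lam * P.α₂' - P.α₂, lam * P.α₁' - P.α₁) ∧
  P.Transmission lam y

/-- The terminal value problem (at `b`) that defines `ψ(·, lam)`. -/
def IsPsi (lam : ℂ) (y : PiecewiseFun) : Prop :=
  P.SolvesEq lam y ∧
  y.right P.b = (lam * P.γ₂' + P.γ₂, lam * P.γ₁' + P.γ₁) ∧
  y.mid P.ξ₂ = ((y.right P.ξ₂).1 / P.α₅,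
    P.α₅ * (y.right P.ξ₂).2 - (P.α₆ + lam) * (y.right P.ξ₂).1) ∧
  y.left P.ξ₁ = ((y.mid P.ξ₁).1 / P.α₃,
    P.α₃ * (y.mid P.ξ₁).2 - (P.α₄ + lam) * (y.mid P.ξ₁).1)

/-- The solution `φ(·, lam)`. (Its pieces are determined on the three closed subintervals, and
only their values there are used.) -/
noncomputable def phi (lam : ℂ) : PiecewiseFun := Classical.epsilon (P.IsPhi lam)

/-- The solution `ψ(·, lam)`. -/
noncomputable def psi (lam : ℂ) : PiecewiseFun := Classical.epsilon (P.IsPsi lam)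

/-- The characteristic function `Δ(lam) = W(φ, ψ, b)`. -/
noncomputable def charFun (lam : ℂ) : ℂ :=
  wronskian ((P.phi lam).right P.b) ((P.psi lam).right P.b)

/-- The Weyl function
`M(lam) = (α₁' ψ₁(a, lam) - α₂' ψ₂(a, lam)) / (d₁ Δ(lam))`. -/
noncomputable def weylFun (lam : ℂ) : ℂ :=
  (P.α₁' * ((P.psi lam).left P.a).1 - P.α₂' * ((P.psi lam).left P.a).2) /
    (P.d₁ * P.charFun lam)

/-- The normalizing constant `μ` (of an eigenvalue `lam`). -/
noncomputable def normConst (lam : ℂ) : ℂ :=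
  P.ρ₁ * (∫ x in P.a..P.ξ₁, (((P.phi lam).left x).1 ^ 2 + ((P.phi lam).left x).2 ^ 2))
  + P.ρ₂ * (∫ x in P.ξ₁..P.ξ₂, (((P.phi lam).mid x).1 ^ 2 + ((P.phi lam).mid x).2 ^ 2))
  + P.ρ₃ * (∫ x in P.ξ₂..P.b, (((P.phi lam).right x).1 ^ 2 + ((P.phi lam).right x).2 ^ 2))
  + P.α₃ * ((P.phi lam).left P.ξ₁).1 ^ 2
  + P.α₅ * ((P.phi lam).mid P.ξ₂).1 ^ 2
  + (P.d₁ : ℂ)⁻¹ *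
      (P.α₁' * ((P.phi lam).left P.a).1 - P.α₂' * ((P.phi lam).left P.a).2) ^ 2
  + (P.d₂ : ℂ)⁻¹ *
      (P.γ₁' * ((P.phi lam).right P.b).1 - P.γ₂' * ((P.phi lam).right P.b).2) ^ 2

/-- `ev` lists the eigenvalues, each exactly once, indexed by the integers. -/
def IsEnumeration (ev : ℤ → ℂ) : Prop :=
  Function.Injective ev ∧ range ev = P.eigenvalues

end DiracProblem

/-! The boundary and transmission conditions make the problem symmetric on `L₂ ⊕ ℂ⁴`, the four extra
components coming from the conditions that contain `λ`; `μₙ` is the squared norm of the `n`-th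
eigenvector there. No operator theory is used: everything follows from Lagrange's identity and
complex analysis.

Let `N` be the numerator `α₁'ψ₁(a) - α₂'ψ₂(a)`, so that `M = N / (d₁ Δ)`. Both `N` and `Δ` are
entire, because solutions depend holomorphically on `λ` (a Volterra argument), and the zeros of `Δ`
are the eigenvalues. Lagrange's identity for `ψ` and its conjugate computes the imaginary part of
`Δ` times the conjugate of `N` (`charFun_lower_bound`). This is the Herglotz property of `M`; it
shows that the zeros of `Δ` are real and that `|N| |Im λ| ≤ |Δ|`. At an eigenvalue `ψ = k φ`, and
Lagrange's identity for `φ(·, λ)` and `ψ(·, λₙ)` gives `Δ'(λₙ) = -k μₙ` and `N(λₙ) = k d₁`. Since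
`φ` is real there, `μₙ > 0`; so the zeros are simple and `M` has residue `-1/μₙ`.

The component of the eigenvector that belongs to the condition at `a` always equals `d₁`, so
Bessel's inequality for the unit vector of that component reads `∑ 1/μₙ ≤ 1/d₁`
(`sum_inv_normConst_le`). Hence the series converges absolutely. Its difference from `M` extends to
an entire function bounded by a constant times `1/|Im λ|`, and such a function vanishes
(`eq_zero_of_norm_mul_abs_im_le`, `hasSum_partialFraction`).

The convergent sum also makes the eigenvalues countable. If they were finite in number, the same
partial fraction argument would make `1/Δ` rational, against the exponential growth of `Δ` on the
imaginary axis (`infinite_zeros_of_exp_growth`, `exp_le_charFun`). -/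

/-! ### Entire functions: a Liouville theorem, partial fractions, infinitely many zeros -/

theorem dslope_eq_of_ne_of_zero {f : ℂ → ℂ} {a z : ℂ} (ha : f a = 0) (h : z ≠ a) :
    dslope f a z = f z / (z - a) := by
  rw [dslope_of_ne _ h, slope_def_field, ha, sub_zero]

theorem differentiable_dslope {f : ℂ → ℂ} (hf : Differentiable ℂ f) (a : ℂ) :
    Differentiable ℂ (dslope f a) := by
  rw [← differentiableOn_univ] at hf ⊢
  exact (Complex.differentiableOn_dslope Filter.univ_mem).2 hf

/-- The quotient of two entire functions is entire when every zero of the denominator is simple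
and a zero of the numerator. -/
theorem exists_differentiable_div {h D : ℂ → ℂ} (hh : Differentiable ℂ h) (hD : Differentiable ℂ D)
    (h0 : ∀ z, D z = 0 → h z = 0) (hs : ∀ z, D z = 0 → deriv D z ≠ 0) :
    ∃ g : ℂ → ℂ, Differentiable ℂ g ∧ ∀ z, D z ≠ 0 → g z = h z / D z := by
  classical
  -- Near a common zero the quotient is that of the two divided differences, whose denominator is
  -- nonzero because the zero of `D` is simple.
  refine ⟨fun z => if D z = 0 then deriv h z / deriv D z else h z / D z, fun z => ?_,
    fun z hz => if_neg hz⟩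
  by_cases hz : D z = 0
  · have h1 : DifferentiableAt ℂ (fun w => dslope h z w / dslope D z w) z :=
      (differentiable_dslope hh z z).div (differentiable_dslope hD z z)
        (by rw [dslope_same]; exact hs z hz)
    refine h1.congr_of_eventuallyEq ?_
    have h2 : ∀ᶠ w in nhds z, dslope D z w ≠ 0 :=
      (differentiable_dslope hD z).continuous.continuousAt.eventually_ne
        (by rw [dslope_same]; exact hs z hz)
    filter_upwards [h2] with w hw
    by_cases hwz : w = z
    · simp [hwz, hz, dslope_same]
    · have hsub : w - z ≠ 0 := sub_ne_zero.2 hwz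
      rw [dslope_eq_of_ne_of_zero hz hwz] at hw
      have : D w ≠ 0 := fun h => hw (by rw [h, zero_div])
      rw [if_neg this, dslope_eq_of_ne_of_zero hz hwz, dslope_eq_of_ne_of_zero (h0 z hz) hwz]
      field_simp
  · have h1 : DifferentiableAt ℂ (fun w => h w / D w) z := (hh z).div (hD z) hz
    refine h1.congr_of_eventuallyEq ?_
    filter_upwards [hD.continuous.continuousAt.eventually_ne hz] with w hw
    exact if_neg hw

/-- On the circle, `R²` is `z` times its conjugate. The factor `|Im z|` is what cancels a bound `C /
|Im z|`, including its singularities at `±R`. -/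
theorem Complex.norm_sq_sub_sq_of_norm_eq {z : ℂ} {R : ℝ} (hz : ‖z‖ = R) :
    ‖z ^ 2 - (R : ℂ) ^ 2‖ = 2 * R * |z.im| := by
  have : z ^ 2 - (R : ℂ) ^ 2 = z * (z - (starRingEnd ℂ) z) := by
    rw [mul_sub, Complex.mul_conj, Complex.normSq_eq_norm_sq, hz]
    push_cast
    ring
  rw [this, Complex.sub_conj, norm_mul, hz]
  simp
  ring

/-- An entire function `g` with `‖g z‖ ≤ C / |Im z|` vanishes. -/
theorem eq_zero_of_norm_mul_abs_im_le {g : ℂ → ℂ} (hg : Differentiable ℂ g) {C : ℝ}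
    (hC : ∀ z : ℂ, ‖g z‖ * |z.im| ≤ C) (z : ℂ) : g z = 0 := by
  have key : ∀ R : ℝ, ‖z‖ < R → ‖g z‖ ≤ 2 * R * C / (R ^ 2 - ‖z‖ ^ 2) := by
    intro R hR
    have hR0 : 0 < R := (norm_nonneg z).trans_lt hR
    have hpos : 0 < R ^ 2 - ‖z‖ ^ 2 := by nlinarith [norm_nonneg z]
    -- Maximum principle on the disc of radius `R`. After division by `R² - ‖z‖²` the bound is
    -- `O(1/R)`.
    have h1 : ‖g z * (z ^ 2 - (R : ℂ) ^ 2)‖ ≤ 2 * R * C := by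
      refine Complex.norm_le_of_forall_mem_frontier_norm_le (U := Metric.ball 0 R)
        (f := fun w => g w * (w ^ 2 - (R : ℂ) ^ 2)) Metric.isBounded_ball ?_ ?_
        (subset_closure (by simpa using hR))
      · exact (hg.mul (by fun_prop)).diffContOnCl
      · intro w hw
        rw [frontier_ball _ hR0.ne'] at hw
        have hw' : ‖w‖ = R := by simpa using hw
        rw [norm_mul, Complex.norm_sq_sub_sq_of_norm_eq hw']
        nlinarith [hC w]
    rw [le_div_iff₀ hpos]
    rw [norm_mul] at h1
    refine le_trans (mul_le_mul_of_nonneg_left ?_ (norm_nonneg _)) h1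
    have := norm_sub_norm_le ((R : ℂ) ^ 2) (z ^ 2)
    rw [norm_sub_rev] at this
    simpa [abs_of_pos hR0] using this
  have hlim : Filter.Tendsto (fun R : ℝ => 2 * R * C / (R ^ 2 - ‖z‖ ^ 2)) Filter.atTop (nhds 0) := by
    have h1 : Filter.Tendsto (fun R : ℝ => 2 * C * (R⁻¹) / (1 - ‖z‖ ^ 2 * (R⁻¹) ^ 2)) Filter.atTop
        (nhds (2 * C * 0 / (1 - ‖z‖ ^ 2 * 0 ^ 2))) := by
      have := tendsto_inv_atTop_zero (𝕜 := ℝ)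
      exact (this.const_mul _).div ((this.pow 2).const_mul _ |>.const_sub 1) (by simp)
    simp only [mul_zero, zero_div] at h1
    refine h1.congr' ?_
    filter_upwards [Filter.eventually_gt_atTop 0] with R hR
    have : R ^ 2 - ‖z‖ ^ 2 = R ^ 2 * (1 - ‖z‖ ^ 2 * R⁻¹ ^ 2) := by field_simp
    have h2 : 2 * R * C = R ^ 2 * (2 * C * R⁻¹) := by field_simp
    rw [this, h2, mul_div_mul_left _ _ (by positivity)]
  have : ‖g z‖ ≤ 0 := ge_of_tendsto hlim (by
    filter_upwards [Filter.eventually_gt_atTop ‖z‖] with R hR using key R hR)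
  simpa using this

/-- Partial fractions for a quotient `N / D` of entire functions, where `D` has simple real zeros,
the residues are summable and `N / D = O(1 / |Im z|)`. -/
theorem hasSum_partialFraction {ι : Type*} {N D : ℂ → ℂ} (hN : Differentiable ℂ N)
    (hD : Differentiable ℂ D) {ev : ι → ℂ} (hinj : Function.Injective ev)
    (hreal : ∀ i, (ev i).im = 0) (hzero : ∀ z, D z = 0 ↔ z ∈ range ev)
    (hsimple : ∀ i, deriv D (ev i) ≠ 0)
    (hsum : Summable fun i => ‖N (ev i) / deriv D (ev i)‖) {C : ℝ}
    (hC : ∀ z : ℂ, ‖N z‖ * |z.im| ≤ C * ‖D z‖) {z : ℂ} (hz : D z ≠ 0) :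
    HasSum (fun i => -(N (ev i) / deriv D (ev i)) / (ev i - z)) (N z / D z) := by
  set c : ι → ℂ := fun i => -(N (ev i) / deriv D (ev i)) with hc
  have hsc : Summable fun i => ‖c i‖ := by simpa [hc] using hsum
  have hev0 : ∀ i, D (ev i) = 0 := fun i => (hzero _).2 ⟨i, rfl⟩
  -- the entire function `N + ∑ c i * dslope D (ev i)`
  set h : ℂ → ℂ := fun w => N w + ∑' i, c i * dslope D (ev i) w with hh
  -- The bound must be uniform in `i`: for nearby zeros by the mean value inequality, for zeros at
  -- distance at least `1` from `w` because `D (ev i) = 0`.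
  have hbound : ∀ r : ℝ, ∃ K : ℝ, ∀ i, ∀ w ∈ Metric.ball (0 : ℂ) r, ‖dslope D (ev i) w‖ ≤ K := by
    intro r
    obtain ⟨K₁, hK₁⟩ := (isCompact_closedBall (0 : ℂ) (r + 1)).exists_bound_of_continuousOn
      (f := deriv D) (hD.contDiff.continuous_deriv le_rfl).continuousOn
    obtain ⟨K₂, hK₂⟩ := (isCompact_closedBall (0 : ℂ) (r + 1)).exists_bound_of_continuousOn
      (f := D) hD.continuous.continuousOn
    refine ⟨max K₁ K₂, fun i w hw => ?_⟩
    have hw1 : ‖w‖ < r := by simpa using hw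
    have hwm : w ∈ Metric.closedBall (0 : ℂ) (r + 1) := by simp; linarith
    by_cases hi : ‖ev i‖ ≤ r + 1
    · refine le_trans ?_ (le_max_left _ _)
      have him : ev i ∈ Metric.closedBall (0 : ℂ) (r + 1) := by simpa using hi
      by_cases hwi : w = ev i
      · rw [hwi, dslope_same]; exact hK₁ _ him
      · rw [dslope_of_ne _ hwi, slope_def_field, norm_div,
          div_le_iff₀ (norm_pos_iff.2 (sub_ne_zero.2 hwi))]
        exact (convex_closedBall (0 : ℂ) (r + 1)).norm_image_sub_le_of_norm_deriv_le
          (fun x _ => hD x) hK₁ him hwm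
    · refine le_trans ?_ (le_max_right _ _)
      have hwi : w ≠ ev i := by rintro rfl; linarith
      have hd : 1 ≤ ‖w - ev i‖ := by
        have := norm_sub_norm_le (ev i) w
        rw [norm_sub_rev] at this
        linarith
      rw [dslope_eq_of_ne_of_zero (hev0 i) hwi, norm_div]
      exact (div_le_self (norm_nonneg _) hd).trans (hK₂ w hwm)
  have hdh : Differentiable ℂ h := by
    refine hN.add ?_
    intro w
    obtain ⟨K, hK⟩ := hbound (‖w‖ + 1)
    have := Complex.differentiableOn_tsum_of_summable_norm (u := fun i => ‖c i‖ * K)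
      (F := fun i w => c i * dslope D (ev i) w) (U := Metric.ball (0 : ℂ) (‖w‖ + 1))
      (hsc.mul_right K)
      (fun i => ((differentiable_dslope hD (ev i)).const_mul (c i)).differentiableOn)
      Metric.isOpen_ball (fun i w hw => by
        rw [norm_mul]; exact mul_le_mul_of_nonneg_left (hK i w hw) (norm_nonneg _))
    exact this.differentiableAt (Metric.isOpen_ball.mem_nhds (by simp))
  -- At `ev k` only the `k`-th term survives, and `c k` is chosen so that it cancels `N (ev k)`.
  have hh0 : ∀ w, D w = 0 → h w = 0 := by
    intro w hw
    obtain ⟨k, rfl⟩ := (hzero w).1 hw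
    have : ∑' i, c i * dslope D (ev i) (ev k) = c k * deriv D (ev k) := by
      rw [tsum_eq_single k, dslope_same]
      intro i hi
      rw [dslope_eq_of_ne_of_zero (hev0 i) (fun h => hi (hinj h).symm), hw]
      simp
    have h2 : h (ev k) = N (ev k) + c k * deriv D (ev k) := congrArg (N (ev k) + ·) this
    rw [h2]
    have := hsimple k
    simp only [hc]
    field_simp
    ring
  have hne : ∀ w, D w ≠ 0 → ∀ i, ev i - w ≠ 0 := fun w hw i h => hw (by
    rw [← sub_eq_zero.1 h]; exact hev0 i)
  have hterm : ∀ w, D w ≠ 0 → ∀ i, c i * dslope D (ev i) w = -D w * (c i / (ev i - w)) := by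
    intro w hw i
    have h1 := hne w hw i
    have h2 : w - ev i ≠ 0 := by rwa [← neg_ne_zero, neg_sub]
    rw [dslope_eq_of_ne_of_zero (hev0 i) (sub_ne_zero.1 h2), ← neg_sub w, div_neg]
    field_simp
  have hsumm : ∀ w, D w ≠ 0 → Summable fun i => c i / (ev i - w) := by
    intro w hw
    obtain ⟨K, hK⟩ := hbound (‖w‖ + 1)
    have h1 : Summable fun i => c i * dslope D (ev i) w :=
      Summable.of_norm_bounded (hsc.mul_right K) (fun i => by
        rw [norm_mul]; exact mul_le_mul_of_nonneg_left (hK i w (by simp)) (norm_nonneg _))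
    simp_rw [hterm w hw] at h1
    exact (summable_mul_left_iff (neg_ne_zero.2 hw)).1 h1
  have hhD : ∀ w, D w ≠ 0 → h w / D w = N w / D w - ∑' i, c i / (ev i - w) := by
    intro w hw
    simp only [hh, hterm w hw, tsum_mul_left]
    field_simp
    ring
  obtain ⟨g, hg, hgD⟩ := exists_differentiable_div hdh hD hh0 (fun w hw => by
    obtain ⟨k, rfl⟩ := (hzero w).1 hw; exact hsimple k)
  -- As the `ev i` are real, `|ev i - w| ≥ |Im w|`. The maximum with `0` serves real `w`, where the
  -- left side is `0`.
  have hgC : ∀ w : ℂ, ‖g w‖ * |w.im| ≤ max (C + ∑' i, ‖c i‖) 0 := by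
    intro w
    by_cases hw : w.im = 0
    · simp [hw]
    refine le_trans ?_ (le_max_left _ _)
    have hDw : D w ≠ 0 := fun h => by
      obtain ⟨k, rfl⟩ := (hzero w).1 h; exact hw (hreal k)
    have him : 0 < |w.im| := abs_pos.2 hw
    rw [hgD w hDw, hhD w hDw]
    have hle : ∀ i, ‖c i / (ev i - w)‖ ≤ ‖c i‖ * |w.im|⁻¹ := fun i => by
      rw [norm_div, div_eq_mul_inv]
      refine mul_le_mul_of_nonneg_left (inv_anti₀ him ?_) (norm_nonneg _)
      have := Complex.abs_im_le_norm (ev i - w)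
      simpa [hreal i] using this
    have h1 : ‖∑' i, c i / (ev i - w)‖ ≤ (∑' i, ‖c i‖) * |w.im|⁻¹ := by
      rw [← tsum_mul_right]
      exact tsum_of_norm_bounded (hsc.mul_right _).hasSum hle
    have h2 : ‖N w / D w‖ ≤ C * |w.im|⁻¹ := by
      rw [norm_div, div_le_iff₀ (norm_pos_iff.2 hDw), mul_right_comm, ← div_eq_mul_inv,
        le_div_iff₀ him]
      exact hC w
    calc ‖N w / D w - ∑' i, c i / (ev i - w)‖ * |w.im|
        ≤ (C * |w.im|⁻¹ + (∑' i, ‖c i‖) * |w.im|⁻¹) * |w.im| :=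
          mul_le_mul_of_nonneg_right ((norm_sub_le _ _).trans (add_le_add h2 h1)) him.le
      _ = C + ∑' i, ‖c i‖ := by field_simp
  have h0 := eq_zero_of_norm_mul_abs_im_le hg hgC z
  rw [hgD z hz, hhD z hz, sub_eq_zero] at h0
  rw [h0]
  exact (hsumm z hz).hasSum

/-- An entire function with simple real zeros that is bounded below by a multiple of `|Im z|` and
grows exponentially along the positive imaginary axis has infinitely many zeros. -/
theorem infinite_zeros_of_exp_growth {D : ℂ → ℂ} (hD : Differentiable ℂ D)
    (hreal : ∀ z, D z = 0 → z.im = 0) (hsimple : ∀ z, D z = 0 → deriv D z ≠ 0) {C : ℝ}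
    (hC : ∀ z : ℂ, |z.im| ≤ C * ‖D z‖) {c L : ℝ} (hc : 0 < c) (hL : 0 < L)
    (hgrow : ∀ τ : ℝ, 1 ≤ τ → c * Real.exp (L * τ) ≤ ‖D (τ * Complex.I)‖) :
    {z | D z = 0}.Infinite := by
  classical
  intro hfin
  have : Fintype {z | D z = 0} := hfin.fintype
  set ev : {z | D z = 0} → ℂ := Subtype.val with hev
  set r : {z | D z = 0} → ℂ := fun i => -(1 / deriv D (ev i)) with hr
  have hsum : ∀ z, D z ≠ 0 → ∑ i, r i / (ev i - z) = 1 / D z := by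
    intro z hz
    have := hasSum_partialFraction (N := fun _ => 1) (ev := ev) (C := C)
      (differentiable_const _) hD Subtype.val_injective
      (fun i => hreal _ i.2) (fun z => by simp [hev]) (fun i => hsimple _ i.2)
      (Summable.of_finite) (by simpa using hC) hz
    exact (hasSum_fintype _).unique this
  -- The numerator of the finite sum for `1/D` over the common denominator `∏ (ev i - z)`.
  set Q : Polynomial ℂ := ∑ i, Polynomial.C (r i) *
    ∏ j ∈ Finset.univ.erase i, (Polynomial.C (ev j) - Polynomial.X) with hQ
  have hQD : ∀ z, D z ≠ 0 → Q.eval z = (∏ i, (ev i - z)) / D z := by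
    intro z hz
    rw [div_eq_mul_one_div, ← hsum z hz, Finset.mul_sum, hQ, Polynomial.eval_finsetSum]
    refine Finset.sum_congr rfl fun i _ => ?_
    have hne : ev i - z ≠ 0 := fun h => hz (by rw [← sub_eq_zero.1 h]; exact i.2)
    rw [← Finset.mul_prod_erase _ _ (Finset.mem_univ i), Polynomial.eval_mul,
      Polynomial.eval_C, Polynomial.eval_prod]
    simp only [Polynomial.eval_sub, Polynomial.eval_C, Polynomial.eval_X]
    field_simp
  have hDI : ∀ τ : ℝ, 1 ≤ τ → D (τ * Complex.I) ≠ 0 := fun τ hτ h => by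
    have := hreal _ h
    simp at this
    linarith
  set n := Fintype.card {z | D z = 0}
  set K : ℝ := ∏ i, (‖ev i‖ + 1)
  have hQle : ∀ τ : ℝ, 1 ≤ τ → ‖Q.eval (τ * Complex.I)‖ ≤ K / c * (τ ^ n * Real.exp (-(L * τ))) := by
    intro τ hτ
    rw [hQD _ (hDI τ hτ), norm_div, norm_prod]
    have h1 : ∏ i, ‖ev i - τ * Complex.I‖ ≤ K * τ ^ n := by
      have : K * τ ^ n = ∏ i, ((‖ev i‖ + 1) * τ) := by
        rw [Finset.prod_mul_distrib, Finset.prod_const, Finset.card_univ]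
      rw [this]
      refine Finset.prod_le_prod (fun _ _ => norm_nonneg _) fun i _ => ?_
      have h2 := norm_sub_le (ev i) (τ * Complex.I)
      have h3 : ‖(τ : ℂ) * Complex.I‖ = τ := by
        simp [abs_of_nonneg (zero_le_one.trans hτ)]
      nlinarith [norm_nonneg (ev i)]
    have hK : 0 ≤ K * τ ^ n := (Finset.prod_nonneg fun _ _ => norm_nonneg _).trans h1
    calc _ ≤ K * τ ^ n / (c * Real.exp (L * τ)) :=
          div_le_div₀ hK h1 (by positivity) (hgrow τ hτ)
      _ = _ := by rw [Real.exp_neg]; field_simp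
  have hlim : Filter.Tendsto (fun τ : ℝ => ‖Q.eval (τ * Complex.I)‖) Filter.atTop (nhds 0) := by
    have h1 : Filter.Tendsto (fun τ : ℝ => τ ^ n * Real.exp (-(L * τ))) Filter.atTop (nhds 0) := by
      refine (isLittleO_pow_exp_pos_mul_atTop n hL).tendsto_div_nhds_zero.congr fun τ => ?_
      rw [Real.exp_neg, div_eq_mul_inv]
    have h2 := h1.const_mul (K / c)
    rw [mul_zero] at h2
    refine squeeze_zero' (Filter.Eventually.of_forall fun _ => norm_nonneg _) ?_ h2
    filter_upwards [Filter.eventually_ge_atTop 1] with τ hτ using hQle τ hτ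
  -- A nonconstant polynomial is unbounded along the imaginary axis, and a constant one with limit
  -- `0` is zero.
  have hQ0 : Q = 0 := by
    by_cases hdeg : 0 < Q.degree
    · have hz : Filter.Tendsto (fun τ : ℝ => ‖(τ : ℂ) * Complex.I‖) Filter.atTop Filter.atTop := by
        simpa using Filter.tendsto_abs_atTop_atTop
      exact absurd hlim (not_tendsto_nhds_of_tendsto_atTop (Q.tendsto_norm_atTop hdeg hz) _)
    · rw [Polynomial.eq_C_of_degree_le_zero (not_lt.1 hdeg)] at hlim ⊢
      simp only [Polynomial.eval_C] at hlim
      have := tendsto_nhds_unique hlim tendsto_const_nhds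
      rw [norm_eq_zero.1 this.symm, Polynomial.C_0]
  have h1 := hQD _ (hDI 1 le_rfl)
  rw [hQ0, Polynomial.eval_zero, eq_comm, div_eq_zero_iff, or_iff_left (hDI 1 le_rfl),
    Finset.prod_eq_zero_iff] at h1
  obtain ⟨i, -, hi⟩ := h1
  have := congrArg Complex.im hi
  simp [hreal _ i.2, hev] at this

/-! ### Absolutely continuous functions and their fundamental theorem of calculus -/

section AbsolutelyContinuous

variable {F G : Type*} [NormedAddCommGroup F] [NormedAddCommGroup G]

theorem AbsolutelyContinuousOnInterval.of_dist_le {X Y : Type*} [PseudoMetricSpace X]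
    [PseudoMetricSpace Y] {f : ℝ → X} {g : ℝ → Y} {a b C : ℝ}
    (hg : AbsolutelyContinuousOnInterval g a b)
    (h : ∀ x ∈ uIcc a b, ∀ y ∈ uIcc a b, dist (f x) (f y) ≤ C * dist (g x) (g y)) :
    AbsolutelyContinuousOnInterval f a b := by
  have h0 := Filter.Tendsto.const_mul C hg
  rw [mul_zero] at h0
  refine squeeze_zero' (Filter.Eventually.of_forall fun _ =>
    Finset.sum_nonneg fun _ _ => dist_nonneg) ?_ h0
  refine Filter.mem_inf_of_right (Filter.mem_principal.2 fun I hI => ?_)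
  rw [mem_ofPred_eq, Finset.mul_sum]
  exact Finset.sum_le_sum fun i hi => h _ (hI.1 i hi).1 _ (hI.1 i hi).2

theorem AbsolutelyContinuousOnInterval.continuousLinearMap_comp [NormedSpace ℝ F] [NormedSpace ℝ G]
    {f : ℝ → F} {a b : ℝ} (hf : AbsolutelyContinuousOnInterval f a b) (L : F →L[ℝ] G) :
    AbsolutelyContinuousOnInterval (fun x => L (f x)) a b :=
  hf.of_dist_le (C := ‖L‖) fun x _ y _ => by
    rw [dist_eq_norm, dist_eq_norm, ← map_sub]; exact L.le_opNorm _

theorem AbsolutelyContinuousOnInterval.congr {X : Type*} [PseudoMetricSpace X] {f g : ℝ → X}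
    {a b : ℝ} (hf : AbsolutelyContinuousOnInterval f a b) (h : ∀ x ∈ uIcc a b, g x = f x) :
    AbsolutelyContinuousOnInterval g a b :=
  hf.of_dist_le (C := 1) fun x hx y hy => by rw [h x hx, h y hy, one_mul]

theorem AbsolutelyContinuousOnInterval.prodMk [NormedSpace ℝ F] [NormedSpace ℝ G]
    {f : ℝ → F} {g : ℝ → G} {a b : ℝ}
    (hf : AbsolutelyContinuousOnInterval f a b) (hg : AbsolutelyContinuousOnInterval g a b) :
    AbsolutelyContinuousOnInterval (fun x => (f x, g x)) a b := by
  have := (hf.continuousLinearMap_comp (ContinuousLinearMap.inl ℝ F G)).add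
    (hg.continuousLinearMap_comp (ContinuousLinearMap.inr ℝ F G))
  exact AbsolutelyContinuousOnInterval.congr this fun x _ => by simp

variable [NormedSpace ℝ F]

/-- The increments are dominated by those of the real function `∫ ‖f‖`, which reduces the claim to
the scalar case. -/
theorem IntervalIntegrable.absolutelyContinuousOnInterval_integral {f : ℝ → F} {a b : ℝ}
    (hf : IntervalIntegrable f volume a b) :
    AbsolutelyContinuousOnInterval (fun x => ∫ t in a..x, f t) a b := by
  refine (hf.norm.absolutelyContinuousOnInterval_intervalIntegral left_mem_uIcc).of_dist_le
    (C := 1) fun x hx y hy => ?_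
  have hi : ∀ z ∈ uIcc a b, IntervalIntegrable f volume a z := fun z hz =>
    hf.mono_set (uIcc_subset_uIcc left_mem_uIcc hz)
  rw [one_mul, dist_eq_norm, Real.dist_eq, intervalIntegral.integral_interval_sub_left (hi x hx)
    (hi y hy), intervalIntegral.integral_interval_sub_left (hi x hx).norm (hi y hy).norm]
  exact intervalIntegral.norm_integral_le_abs_integral_norm

/-- The fundamental theorem of calculus for absolutely continuous functions. -/
theorem AbsolutelyContinuousOnInterval.sub_eq_integral [CompleteSpace F] {f f' : ℝ → F} {a b : ℝ}
    (hf : AbsolutelyContinuousOnInterval f a b) (hf' : IntervalIntegrable f' volume a b)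
    (h : ∀ᵐ x, x ∈ uIcc a b → HasDerivAt f (f' x) x) :
    f b - f a = ∫ t in a..b, f' t := by
  have hac := hf.sub hf'.absolutelyContinuousOnInterval_integral
  obtain ⟨C, hC⟩ := hac.const_of_ae_hasDerivAt_zero (by
    filter_upwards [h, hf'.ae_hasDerivAt_integral] with x h1 h2 hx
    simpa using (h1 hx).sub (h2 hx a left_mem_uIcc))
  have h1 := (hC b right_mem_uIcc).trans (hC a left_mem_uIcc).symm
  simp only [Pi.sub_apply, intervalIntegral.integral_same, sub_zero] at h1
  rw [← h1]; abel

end AbsolutelyContinuous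

theorem AbsolutelyContinuousOnInterval.pow {f : ℝ → ℝ} {a b : ℝ}
    (hf : AbsolutelyContinuousOnInterval f a b) (n : ℕ) :
    AbsolutelyContinuousOnInterval (fun x => f x ^ n) a b := by
  induction n with
  | zero => simpa using (LipschitzWith.const (1 : ℝ)).lipschitzOnWith.absolutelyContinuousOnInterval
  | succ n ih => simpa only [pow_succ] using! ih.mul hf

/-- `∫ k Kⁿ = Kⁿ⁺¹ / (n + 1)` for a primitive `K` of an integrable function `k`. -/
theorem integral_mul_primitive_pow {k : ℝ → ℝ} {c d : ℝ} (hk : IntervalIntegrable k volume c d)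
    (n : ℕ) :
    ∫ t in c..d, k t * (∫ s in c..t, k s) ^ n = (∫ s in c..d, k s) ^ (n + 1) / (n + 1) := by
  have hK := hk.absolutelyContinuousOnInterval_integral
  have hint : IntervalIntegrable (fun t => k t * (∫ s in c..t, k s) ^ n) volume c d :=
    hk.mul_continuousOn (hK.continuousOn.pow n)
  have h := ((hK.pow (n + 1)).const_mul ((n + 1 : ℝ)⁻¹)).sub_eq_integral hint (by
    filter_upwards [hk.ae_hasDerivAt_integral] with x h1 hx
    have h2 := ((h1 hx c left_mem_uIcc).pow (n + 1)).const_mul ((n + 1 : ℝ)⁻¹)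
    convert! h2 using 1
    have : (n + 1 : ℝ) ≠ 0 := by positivity
    push_cast
    field_simp)
  rw [← h]
  simp [div_eq_inv_mul]

/-! ### Volterra equations and holomorphic dependence on the parameter -/

section Volterra

variable {E : Type*} [NormedAddCommGroup E] [NormedSpace ℂ E] {c d : ℝ} {a : ℝ → E →L[ℂ] E}

theorem IntervalIntegrable.clm_apply_IccExtend (hcd : c ≤ d)
    (ha : IntervalIntegrable a volume c d) (f : C(Icc c d, E)) :
    IntervalIntegrable (fun t => a t (IccExtend hcd f t)) volume c d := by
  refine (ha.norm.mul_const ‖f‖).mono_fun ?_ ?_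
  · exact (ContinuousLinearMap.apply ℂ E).flip.aestronglyMeasurable_comp₂
      ha.aestronglyMeasurable_restrict_uIoc
      ((f.continuous.Icc_extend' (h := hcd)).aestronglyMeasurable)
  · refine Filter.Eventually.of_forall fun t => ?_
    simp only [norm_mul, norm_norm]
    exact (a t).le_opNorm_of_le (f.norm_coe_le_norm _)

/-- The Volterra operator `f ↦ ∫_c^x a(t) f(t) dt` on continuous functions. -/
noncomputable def volterra (hcd : c ≤ d) (ha : IntervalIntegrable a volume c d) :
    C(Icc c d, E) →L[ℂ] C(Icc c d, E) :=
  LinearMap.mkContinuous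
    { toFun := fun f =>
        ⟨fun x => ∫ t in c..x, a t (IccExtend hcd f t), by
          have h := (ha.clm_apply_IccExtend hcd f).absolutelyContinuousOnInterval_integral.continuousOn
          rw [uIcc_of_le hcd] at h
          exact h.domRestrict⟩
      map_add' := fun f g => by
        ext x
        have hs : uIcc c (x : ℝ) ⊆ uIcc c d :=
          uIcc_subset_uIcc left_mem_uIcc (by rw [uIcc_of_le hcd]; exact x.2)
        change (∫ t in c..x, a t (IccExtend hcd f t + IccExtend hcd g t)) =
          (∫ t in c..x, a t (IccExtend hcd f t)) + ∫ t in c..x, a t (IccExtend hcd g t)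
        rw [← intervalIntegral.integral_add ((ha.clm_apply_IccExtend hcd f).mono_set hs)
          ((ha.clm_apply_IccExtend hcd g).mono_set hs)]
        simp only [map_add]
      map_smul' := fun r f => by
        ext x
        change (∫ t in c..x, a t (r • IccExtend hcd f t)) =
          r • ∫ t in c..x, a t (IccExtend hcd f t)
        rw [← intervalIntegral.integral_smul]
        simp only [map_smul] }
    (∫ t in c..d, ‖a t‖) (fun f => by
      refine (ContinuousMap.norm_le _ (mul_nonneg (intervalIntegral.integral_nonneg hcd
        fun _ _ => norm_nonneg _) (norm_nonneg _))).2 fun x => ?_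
      have hs : uIcc c (x : ℝ) ⊆ uIcc c d :=
        uIcc_subset_uIcc left_mem_uIcc (by rw [uIcc_of_le hcd]; exact x.2)
      rw [← intervalIntegral.integral_mul_const]
      calc _ ≤ ∫ t in c..x, ‖a t‖ * ‖f‖ :=
            intervalIntegral.norm_integral_le_of_norm_le x.2.1
              (Filter.Eventually.of_forall fun t _ => (a t).le_opNorm_of_le (f.norm_coe_le_norm _))
              ((ha.norm.mul_const _).mono_set hs)
        _ ≤ _ := intervalIntegral.integral_mono_interval le_rfl x.2.1 x.2.2
              (Filter.Eventually.of_forall fun t => by positivity) (ha.norm.mul_const _))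

theorem volterra_apply (hcd : c ≤ d) (ha : IntervalIntegrable a volume c d) (f : C(Icc c d, E))
    (x : Icc c d) : volterra hcd ha f x = ∫ t in c..x, a t (IccExtend hcd f t) := rfl

/-- Induction on `n`: integrating `‖a‖` times the `n`-th power of its primitive supplies the next
factor `1/(n + 1)`. The factorial removes any need for a short interval. -/
theorem norm_volterra_pow_apply_le (hcd : c ≤ d) (ha : IntervalIntegrable a volume c d)
    (f : C(Icc c d, E)) (n : ℕ) (x : Icc c d) :
    ‖(volterra hcd ha ^ n) f x‖ ≤ ‖f‖ * (∫ t in c..x, ‖a t‖) ^ n / n.factorial := by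
  induction n generalizing x with
  | zero => simpa using f.norm_coe_le_norm x
  | succ n ih =>
    have hs : uIcc c (x : ℝ) ⊆ uIcc c d :=
      uIcc_subset_uIcc left_mem_uIcc (by rw [uIcc_of_le hcd]; exact x.2)
    rw [pow_succ', mul_apply_eq_comp, volterra_apply]
    have hax := ha.norm.mono_set hs
    calc _ ≤ ∫ t in c..x, ‖f‖ / n.factorial * (‖a t‖ * (∫ s in c..t, ‖a s‖) ^ n) := by
          refine intervalIntegral.norm_integral_le_of_norm_le x.2.1
            (Filter.Eventually.of_forall fun t ht => ?_) ?_
          · have htm : t ∈ Icc c d := ⟨ht.1.le, ht.2.trans x.2.2⟩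
            rw [IccExtend_of_mem _ _ htm]
            refine ((a t).le_opNorm_of_le (ih ⟨t, htm⟩)).trans (le_of_eq ?_)
            ring
          · exact (hax.mul_continuousOn
              (hax.absolutelyContinuousOnInterval_integral.continuousOn.pow n)).const_mul _
      _ = _ := by
          rw [intervalIntegral.integral_const_mul, integral_mul_primitive_pow hax,
            Nat.factorial_succ]
          push_cast
          field_simp

/-- Some power `Vⁿ` has norm below `1`, so `1 - Vⁿ` is invertible; it is the product of `1 - V` with
a commuting geometric sum, so `1 - V` is invertible too. -/
theorem isUnit_one_sub_volterra [CompleteSpace E] (hcd : c ≤ d) (ha : IntervalIntegrable a volume c d) :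
    IsUnit (1 - volterra hcd ha) := by
  set K := ∫ t in c..d, ‖a t‖
  obtain ⟨n, hn⟩ := ((FloorSemiring.tendsto_pow_div_factorial_atTop K).eventually_lt_const
    (zero_lt_one' ℝ)).exists
  have hnorm : ‖volterra hcd ha ^ n‖ < 1 := by
    refine lt_of_le_of_lt (ContinuousLinearMap.opNorm_le_bound _ ?_ fun f => ?_) hn
    · exact div_nonneg (pow_nonneg (intervalIntegral.integral_nonneg hcd
        fun _ _ => norm_nonneg _) _) (Nat.cast_nonneg _)
    · refine (ContinuousMap.norm_le _ ?_).2 fun x => ?_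
      · exact mul_nonneg (div_nonneg (pow_nonneg (intervalIntegral.integral_nonneg hcd
          fun _ _ => norm_nonneg _) _) (Nat.cast_nonneg _)) (norm_nonneg _)
      · refine (norm_volterra_pow_apply_le hcd ha f n x).trans ?_
        rw [mul_comm, mul_div_right_comm]
        gcongr
        · exact intervalIntegral.integral_nonneg x.2.1 fun _ _ => norm_nonneg _
        · exact intervalIntegral.integral_mono_interval le_rfl x.2.1 x.2.2
            (Filter.Eventually.of_forall fun t => by positivity) ha.norm
  have hu := isUnit_one_sub_of_norm_lt_one
    (R := C(Icc c d, E) →L[ℂ] C(Icc c d, E)) hnorm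
  rw [← mul_neg_geom_sum] at hu
  have hcomm : Commute (1 - volterra hcd ha) (∑ i ∈ Finset.range n, volterra hcd ha ^ i) :=
    Commute.sum_right _ _ _ fun i _ =>
      (Commute.one_left _).sub_left ((Commute.refl (volterra hcd ha)).pow_right i)
  exact (hcomm.isUnit_mul_iff.1 hu).1

/-- The solutions of `y = ι v + (U + lam V) y` depend holomorphically on `lam` and `v`. -/
theorem exists_inverse_pencil {X : Type*} [NormedAddCommGroup X] [NormedSpace ℂ X]
    [CompleteSpace X] (U V : X →L[ℂ] X) (ι : E →L[ℂ] X)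
    (h : ∀ lam : ℂ, IsUnit (1 - (U + lam • V))) :
    ∃ S : ℂ → E → X,
      (∀ v : ℂ → E, Differentiable ℂ v → ∀ L : X →L[ℂ] E,
        Differentiable ℂ fun lam => L (S lam (v lam))) ∧
      (∀ v : ℂ → E, Continuous v → Continuous fun lam => S lam (v lam)) ∧
      (∀ lam v, S lam v - (U + lam • V) (S lam v) = ι v) ∧
      ∀ lam v y, y - (U + lam • V) y = ι v → y = S lam v := by
  -- Inversion is holomorphic on the units, and the pencil is affine in `lam`.
  have hS : Differentiable ℂ fun lam : ℂ => Ring.inverse (1 - (U + lam • V)) := fun lam => by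
    have h1 : DifferentiableAt ℂ (fun lam : ℂ => 1 - (U + lam • V)) lam :=
      ((differentiableAt_id.smul_const V).const_add U).const_sub 1
    exact (differentiableAt_inverse (h lam)).comp lam h1
  refine ⟨fun lam v => Ring.inverse (1 - (U + lam • V)) (ι v), fun v hv L => ?_, fun v hv => ?_,
    fun lam v => ?_, fun lam v y hy => ?_⟩
  · exact L.differentiable.comp (hS.clm_apply (ι.differentiable.comp hv))
  · exact hS.continuous.clm_apply (ι.continuous.comp hv)
  · change ((1 - (U + lam • V)) * Ring.inverse (1 - (U + lam • V))) (ι v) = ι v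
    rw [Ring.mul_inverse_cancel _ (h lam), one_apply_eq_self]
  · have h1 : (1 - (U + lam • V)) y = ι v := hy
    change y = Ring.inverse (1 - (U + lam • V)) (ι v)
    rw [← h1, ← mul_apply_eq_comp, Ring.inverse_mul_cancel _ (h lam), one_apply_eq_self]

/-- The solutions of the linear differential equations `y' = (a₀ + lam a₁) y` with integrable
coefficients depend holomorphically on `lam` and the initial value. -/
theorem exists_solution_operator [CompleteSpace E] (hcd : c ≤ d) {a₀ a₁ : ℝ → E →L[ℂ] E}
    (h₀ : IntervalIntegrable a₀ volume c d) (h₁ : IntervalIntegrable a₁ volume c d) :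
    ∃ S : ℂ → E → C(Icc c d, E),
      (∀ v : ℂ → E, Differentiable ℂ v → ∀ x, Differentiable ℂ fun lam => S lam (v lam) x) ∧
      (∀ v : ℂ → E, Continuous v → Continuous fun lam => S lam (v lam)) ∧
      (∀ lam v x, S lam v x =
        v + ∫ t in c..x, (a₀ t + lam • a₁ t) (IccExtend hcd (S lam v) t)) ∧
      ∀ lam v (y : C(Icc c d, E)), (∀ x : Icc c d, y x =
        v + ∫ t in c..x, (a₀ t + lam • a₁ t) (IccExtend hcd y t)) → y = S lam v := by
  have hl : ∀ lam : ℂ, IntervalIntegrable (fun t => a₀ t + lam • a₁ t) volume c d := fun lam =>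
    h₀.add (h₁.smul lam)
  have hV : ∀ lam, volterra hcd (hl lam) = volterra hcd h₀ + lam • volterra hcd h₁ := by
    intro lam
    ext f x
    have hs : uIcc c (x : ℝ) ⊆ uIcc c d :=
      uIcc_subset_uIcc left_mem_uIcc (by rw [uIcc_of_le hcd]; exact x.2)
    change (∫ t in c..x, (a₀ t (IccExtend hcd f t) + lam • a₁ t (IccExtend hcd f t))) =
      (∫ t in c..x, a₀ t (IccExtend hcd f t)) + lam • ∫ t in c..x, a₁ t (IccExtend hcd f t)
    rw [← intervalIntegral.integral_smul, ← intervalIntegral.integral_add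
      ((h₀.clm_apply_IccExtend hcd f).mono_set hs)
      (by exact ((h₁.clm_apply_IccExtend hcd f).mono_set hs).smul lam)]
  obtain ⟨S, hSd, hSc, hS1, hS2⟩ := exists_inverse_pencil (volterra hcd h₀) (volterra hcd h₁)
    (ContinuousLinearMap.const ℂ (Icc c d))
    (fun lam => by rw [← hV]; exact isUnit_one_sub_volterra hcd (hl lam))
  simp only [← hV] at hS1 hS2
  refine ⟨S, fun v hv x => hSd v hv (ContinuousMap.evalCLM ℂ x), hSc,
    fun lam v x => ?_, fun lam v y hy => ?_⟩
  · have h2 := congrArg (fun f : C(Icc c d, E) => f x) (hS1 lam v)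
    exact sub_eq_iff_eq_add.1 h2
  · refine hS2 lam _ y ?_
    ext x
    exact sub_eq_iff_eq_add.2 (hy x)

end Volterra

/-! ### The initial value problem on one interval -/

namespace DiracProblem

variable (P : DiracProblem)

theorem intervalIntegrable_of_memLp {f : ℝ → ℝ}
    (hf : MemLp f 2 (volume.restrict (Icc P.a P.b))) {c d : ℝ} (hcd : c ≤ d) (hc : P.a ≤ c)
    (hd : d ≤ P.b) : IntervalIntegrable (fun x => (f x : ℂ)) volume c d := by
  have h1 : IntegrableOn f (Icc P.a P.b) := hf.integrable (by norm_num)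
  have h2 : IntegrableOn (fun x => (f x : ℂ)) (Icc P.a P.b) := Integrable.ofReal h1
  rw [intervalIntegrable_iff, uIoc_of_le hcd]
  exact h2.mono_set (Ioc_subset_Icc_self.trans (Icc_subset_Icc hc hd))

/-- The part of the coefficient matrix of `y' = A y` that does not depend on `lam`. -/
noncomputable def coeff (ρ t : ℝ) : ℂ × ℂ →L[ℂ] ℂ × ℂ :=
  (P.q t : ℂ) • ((ρ : ℂ) •
      (ContinuousLinearMap.fst ℂ ℂ ℂ).prod (-ContinuousLinearMap.snd ℂ ℂ ℂ)) +
    (P.r t : ℂ) • ((ρ : ℂ) • (ContinuousLinearMap.snd ℂ ℂ ℂ).prod 0) +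
    (P.p t : ℂ) • ((ρ : ℂ) •
      (0 : ℂ × ℂ →L[ℂ] ℂ).prod (-ContinuousLinearMap.fst ℂ ℂ ℂ))

/-- The derivative with respect to `lam` of the coefficient matrix of `y' = A y`. -/
noncomputable def coeffDeriv (ρ : ℝ) : ℂ × ℂ →L[ℂ] ℂ × ℂ :=
  (ρ : ℂ) • (-ContinuousLinearMap.snd ℂ ℂ ℂ).prod (ContinuousLinearMap.fst ℂ ℂ ℂ)

theorem coeff_add_apply (ρ t : ℝ) (lam : ℂ) (v : ℂ × ℂ) :
    (P.coeff ρ t + lam • coeffDeriv ρ) v =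
      (ρ * (P.q t * v.1 + P.r t * v.2 - lam * v.2), ρ * (lam * v.1 - P.p t * v.1 - P.q t * v.2)) := by
  ext
  · simp [coeff, coeffDeriv]; ring
  · simp [coeff, coeffDeriv]; ring

variable {P}

theorem intervalIntegrable_coeff {ρ c d : ℝ} (hcd : c ≤ d) (hc : P.a ≤ c) (hd : d ≤ P.b) :
    IntervalIntegrable (P.coeff ρ) volume c d := by
  have h : ∀ {f : ℝ → ℝ} (L : ℂ × ℂ →L[ℂ] ℂ × ℂ), MemLp f 2 (volume.restrict (Icc P.a P.b)) →
      IntervalIntegrable (fun t => (f t : ℂ) • L) volume c d := fun L hf =>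
    ⟨(P.intervalIntegrable_of_memLp hf hcd hc hd).1.smul_const L,
      (P.intervalIntegrable_of_memLp hf hcd hc hd).2.smul_const L⟩
  exact ((h _ P.q_memLp).add (h _ P.r_memLp)).add (h _ P.p_memLp)

theorem ae_of_ae_Icc {c d : ℝ} {p : ℝ → Prop} (hcd : c ≤ d)
    (h : ∀ᵐ x ∂(volume.restrict (Icc c d)), p x) : ∀ᵐ x, x ∈ uIcc c d → p x := by
  rw [uIcc_of_le hcd]
  exact (ae_restrict_iff' measurableSet_Icc).1 h

theorem SolvesOn.continuousOn {ρ c d : ℝ} {lam : ℂ} {y : ℝ → ℂ × ℂ} (hcd : c ≤ d)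
    (h : P.SolvesOn ρ c d lam y) : ContinuousOn y (Icc c d) := by
  have h1 := h.1.continuousOn
  have h2 := h.2.1.continuousOn
  rw [uIcc_of_le hcd] at h1 h2
  exact h1.prodMk h2

theorem SolvesOn.ae_hasDerivAt {ρ c d : ℝ} (hρ : 0 < ρ) {lam : ℂ} {y : ℝ → ℂ × ℂ} (hcd : c ≤ d)
    (h : P.SolvesOn ρ c d lam y) :
    ∀ᵐ x, x ∈ uIcc c d →
      HasDerivAt (fun t => (y t).1) (ρ * (P.q x * (y x).1 + P.r x * (y x).2 - lam * (y x).2)) x ∧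
      HasDerivAt (fun t => (y t).2) (ρ * (lam * (y x).1 - P.p x * (y x).1 - P.q x * (y x).2)) x := by
  filter_upwards [ae_of_ae_Icc hcd h.2.2] with x hx hxm
  obtain ⟨y₁', y₂', h1, h2, e1, e2⟩ := hx hxm
  have hρ' : (ρ : ℂ) ≠ 0 := by exact_mod_cast hρ.ne'
  constructor
  · convert h1 using 1
    field_simp at e2
    linear_combination e2
  · convert h2 using 1
    field_simp at e1
    linear_combination -e1

theorem SolvesOn.eq_add_integral {ρ c d : ℝ} (hρ : 0 < ρ) {lam : ℂ} {y : ℝ → ℂ × ℂ} (hcd : c ≤ d)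
    (hc : P.a ≤ c) (hd : d ≤ P.b) (h : P.SolvesOn ρ c d lam y) {x : ℝ} (hx : x ∈ Icc c d) :
    y x = y c + ∫ t in c..x, (P.coeff ρ t + lam • coeffDeriv ρ) (y t) := by
  have hcont := h.continuousOn hcd
  have hs : uIcc c x ⊆ uIcc c d :=
    uIcc_subset_uIcc left_mem_uIcc (by rw [uIcc_of_le hcd]; exact hx)
  set f : C(Icc c d, ℂ × ℂ) := ⟨(Icc c d).domRestrict y, hcont.domRestrict⟩
  have hint : IntervalIntegrable (fun t => (P.coeff ρ t + lam • coeffDeriv ρ) (y t)) volume c x := by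
    have h1 : IntervalIntegrable (fun t => P.coeff ρ t + lam • coeffDeriv ρ) volume c d :=
      (intervalIntegrable_coeff hcd hc hd).add intervalIntegrable_const
    refine ((h1.clm_apply_IccExtend hcd f).mono_set hs).congr ?_
    intro t ht
    have : t ∈ Icc c d := by
      rw [uIoc_of_le hx.1] at ht
      exact ⟨ht.1.le, ht.2.trans hx.2⟩
    simp only [IccExtend_of_mem _ _ this]
    rfl
  have hac : AbsolutelyContinuousOnInterval y c x :=
    (AbsolutelyContinuousOnInterval.prodMk h.1 h.2.1).mono hs
  rw [← hac.sub_eq_integral hint, add_sub_cancel]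
  filter_upwards [h.ae_hasDerivAt hρ hcd] with t ht htm
  obtain ⟨h1, h2⟩ := ht (hs htm)
  rw [coeff_add_apply]
  exact h1.prodMk h2

/-- Lebesgue differentiation of the integral equation. The end points are discarded as a null set,
because `y` is controlled only inside `[c, d]` and the derivative is two-sided. -/
theorem solvesOn_of_eq_add_integral {ρ c d : ℝ} (hρ : 0 < ρ) {lam : ℂ} {y : ℝ → ℂ × ℂ}
    (hcd : c ≤ d)
    (hint : IntervalIntegrable (fun t => (P.coeff ρ t + lam • coeffDeriv ρ) (y t)) volume c d)
    {v : ℂ × ℂ}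
    (h : ∀ x ∈ Icc c d, y x = v + ∫ t in c..x, (P.coeff ρ t + lam • coeffDeriv ρ) (y t)) :
    P.SolvesOn ρ c d lam y := by
  have hac : AbsolutelyContinuousOnInterval y c d :=
    hint.absolutelyContinuousOnInterval_integral.of_dist_le (C := 1) fun x hx z hz => by
      rw [uIcc_of_le hcd] at hx hz
      rw [h x hx, h z hz, dist_add_left, one_mul]
  refine ⟨hac.continuousLinearMap_comp (ContinuousLinearMap.fst ℝ ℂ ℂ),
    hac.continuousLinearMap_comp (ContinuousLinearMap.snd ℝ ℂ ℂ), ?_⟩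
  have hIoo : ∀ᵐ x ∂(volume.restrict (Icc c d)), x ∈ Ioo c d := by
    rw [← restrict_Ioo_eq_restrict_Icc]
    exact ae_restrict_mem measurableSet_Ioo
  filter_upwards [ae_restrict_of_ae hint.ae_hasDerivAt_integral, hIoo] with x h1 hx
  have h2 := (h1 (by rw [uIcc_of_le hcd]; exact Ioo_subset_Icc_self hx) c left_mem_uIcc).const_add v
  have h3 : HasDerivAt y ((P.coeff ρ x + lam • coeffDeriv ρ) (y x)) x :=
    h2.congr_of_eventuallyEq (by
      filter_upwards [Ioo_mem_nhds hx.1 hx.2] with t ht using h t (Ioo_subset_Icc_self ht))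
  rw [coeff_add_apply] at h3
  have hρ' : (ρ : ℂ) ≠ 0 := by exact_mod_cast hρ.ne'
  refine ⟨_, _, (ContinuousLinearMap.fst ℝ ℂ ℂ).hasFDerivAt.comp_hasDerivAt x h3,
    (ContinuousLinearMap.snd ℝ ℂ ℂ).hasFDerivAt.comp_hasDerivAt x h3, ?_, ?_⟩
  · simp only [ContinuousLinearMap.coe_snd']
    field_simp
    ring
  · simp only [ContinuousLinearMap.coe_fst']
    field_simp
    ring

/-- Existence, uniqueness and holomorphic dependence on the parameter of the solution of the
initial value problem on one interval. -/
theorem exists_solvesOn {ρ c d : ℝ} (hρ : 0 < ρ) (hcd : c ≤ d) (hc : P.a ≤ c) (hd : d ≤ P.b) :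
    ∃ S : ℂ → ℂ × ℂ → ℝ → ℂ × ℂ,
      (∀ v : ℂ → ℂ × ℂ, Differentiable ℂ v → ∀ x, Differentiable ℂ fun lam => S lam (v lam) x) ∧
      (∀ v : ℂ → ℂ × ℂ, Continuous v → Continuous fun p : ℂ × ℝ => S p.1 (v p.1) p.2) ∧
      (∀ lam v, S lam v c = v) ∧
      (∀ lam v, P.SolvesOn ρ c d lam (S lam v)) ∧
      ∀ lam y, P.SolvesOn ρ c d lam y → EqOn y (S lam (y c)) (Icc c d) := by
  have h0 := intervalIntegrable_coeff (P := P) (ρ := ρ) hcd hc hd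
  obtain ⟨S, hSd, hSc, hS1, hS2⟩ := exists_solution_operator hcd h0
    (intervalIntegrable_const (c := coeffDeriv ρ))
  have hext : ∀ lam v, ∀ x ∈ Icc c d, IccExtend hcd (S lam v) x =
      v + ∫ t in c..x, (P.coeff ρ t + lam • coeffDeriv ρ) (IccExtend hcd (S lam v) t) := by
    intro lam v x hx
    rw [IccExtend_of_mem _ _ hx]
    exact hS1 lam v ⟨x, hx⟩
  refine ⟨fun lam v => IccExtend hcd (S lam v), fun v hv x => hSd v hv _, fun v hv => ?_,
    fun lam v => ?_, fun lam v => ?_, fun lam y hy x hx => ?_⟩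
  · have h1 : Continuous fun p : ℂ × ℝ => (S p.1 (v p.1), projIcc c d hcd p.2) :=
      ((hSc v hv).comp continuous_fst).prodMk (continuous_projIcc.comp continuous_snd)
    exact continuous_eval.comp h1
  · refine (hext lam v c (left_mem_Icc.2 hcd)).trans ?_
    rw [intervalIntegral.integral_same, add_zero]
  · refine solvesOn_of_eq_add_integral hρ hcd ?_ (hext lam v)
    have h1 : IntervalIntegrable (fun t => P.coeff ρ t + lam • coeffDeriv ρ) volume c d :=
      h0.add intervalIntegrable_const
    exact h1.clm_apply_IccExtend hcd (S lam v)
  · have h1 := hS2 lam (y c) ⟨(Icc c d).domRestrict y, (hy.continuousOn hcd).domRestrict⟩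
      (fun x => by
        refine (hy.eq_add_integral hρ hcd hc hd x.2).trans ?_
        congr 1
        refine intervalIntegral.integral_congr fun t ht => ?_
        rw [uIcc_of_le x.2.1] at ht
        simp only [IccExtend_of_mem _ _ (show t ∈ Icc c d from ⟨ht.1, ht.2.trans x.2.2⟩)]
        rfl)
    change y x = IccExtend hcd (S lam (y c)) x
    rw [IccExtend_of_mem _ _ hx, ← h1]
    rfl

end DiracProblem

/-! ### Solutions across the transmission points and Lagrange's identity -/

theorem wronskian_smul_left (c : ℂ) (y z : ℂ × ℂ) : wronskian (c • y) z = c * wronskian y z := by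
  simp [wronskian]; ring

theorem wronskian_smul_right (c : ℂ) (y z : ℂ × ℂ) : wronskian y (c • z) = c * wronskian y z := by
  simp [wronskian]; ring

namespace PiecewiseFun

/-- The linear combination `c y + d z`. -/
noncomputable def lincomb (c : ℂ) (y : PiecewiseFun) (d : ℂ) (z : PiecewiseFun) : PiecewiseFun :=
  ⟨fun x => c • y.left x + d • z.left x, fun x => c • y.mid x + d • z.mid x,
    fun x => c • y.right x + d • z.right x⟩

/-- The complex conjugate function. -/
noncomputable def conj (y : PiecewiseFun) : PiecewiseFun :=
  ⟨fun x => star (y.left x), fun x => star (y.mid x), fun x => star (y.right x)⟩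

end PiecewiseFun

namespace DiracProblem

variable {P : DiracProblem}

section OneInterval

variable {ρ c d : ℝ} {lam mu : ℂ} {y z : ℝ → ℂ × ℂ}

theorem SolvesOn.lincomb (hy : P.SolvesOn ρ c d lam y) (hz : P.SolvesOn ρ c d lam z) (k l : ℂ) :
    P.SolvesOn ρ c d lam (fun x => k • y x + l • z x) := by
  refine ⟨(hy.1.const_smul k).add (hz.1.const_smul l),
    (hy.2.1.const_smul k).add (hz.2.1.const_smul l), ?_⟩
  filter_upwards [hy.2.2, hz.2.2] with x ⟨u₁, u₂, h1, h2, e1, e2⟩ ⟨v₁, v₂, g1, g2, f1, f2⟩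
  refine ⟨_, _, (h1.const_smul k).add (g1.const_smul l), (h2.const_smul k).add (g2.const_smul l),
    ?_, ?_⟩
  · simp only [Prod.fst_add, Prod.snd_add, Prod.smul_fst, Prod.smul_snd, smul_eq_mul]
    linear_combination k * e1 + l * f1
  · simp only [Prod.fst_add, Prod.snd_add, Prod.smul_fst, Prod.smul_snd, smul_eq_mul]
    linear_combination k * e2 + l * f2

theorem SolvesOn.conj (hy : P.SolvesOn ρ c d lam y) :
    P.SolvesOn ρ c d (star lam) (fun x => star (y x)) := by
  refine ⟨hy.1.continuousLinearMap_comp Complex.conjCLE.toContinuousLinearMap,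
    hy.2.1.continuousLinearMap_comp Complex.conjCLE.toContinuousLinearMap, ?_⟩
  filter_upwards [hy.2.2] with x ⟨u₁, u₂, h1, h2, e1, e2⟩
  refine ⟨_, _, Complex.conjCLE.hasFDerivAt.comp_hasDerivAt x h1,
    Complex.conjCLE.hasFDerivAt.comp_hasDerivAt x h2, ?_, ?_⟩
  · simpa using congrArg (starRingEnd ℂ) e1
  · simpa using congrArg (starRingEnd ℂ) e2

/-- Lagrange's identity on one interval. -/
theorem SolvesOn.wronskian_sub (hρ : 0 < ρ) (hcd : c ≤ d) (hy : P.SolvesOn ρ c d lam y)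
    (hz : P.SolvesOn ρ c d mu z) {x₀ x : ℝ} (hx₀ : x₀ ∈ Icc c d) (hx : x ∈ Icc c d) :
    wronskian (y x) (z x) - wronskian (y x₀) (z x₀) =
      (mu - lam) * (ρ * ∫ t in x₀..x, ((y t).1 * (z t).1 + (y t).2 * (z t).2)) := by
  have hs : uIcc x₀ x ⊆ uIcc c d := by
    rw [← uIcc_of_le hcd] at hx hx₀
    exact uIcc_subset_uIcc hx₀ hx
  have hac : AbsolutelyContinuousOnInterval (fun t => wronskian (y t) (z t)) x₀ x :=
    ((hy.1.smul hz.2.1).sub (hy.2.1.smul hz.1)).mono hs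
  have hyc := (hy.continuousOn hcd).mono (uIcc_of_le hcd ▸ hs)
  have hzc := (hz.continuousOn hcd).mono (uIcc_of_le hcd ▸ hs)
  have hint : IntervalIntegrable
      (fun t => (mu - lam) * (ρ * ((y t).1 * (z t).1 + (y t).2 * (z t).2))) volume x₀ x :=
    ContinuousOn.intervalIntegrable (by fun_prop)
  have h := hac.sub_eq_integral hint (by
    filter_upwards [hy.ae_hasDerivAt hρ hcd, hz.ae_hasDerivAt hρ hcd] with t h1 h2 ht
    obtain ⟨a1, a2⟩ := h1 (hs ht)
    obtain ⟨b1, b2⟩ := h2 (hs ht)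
    convert! (a1.mul b2).sub (a2.mul b1) using 1
    ring)
  rw [h, intervalIntegral.integral_const_mul, intervalIntegral.integral_const_mul]

end OneInterval

variable (P) in
/-- `y` solves the differential equation and the transmission conditions. -/
def IsSol (lam : ℂ) (y : PiecewiseFun) : Prop := P.SolvesEq lam y ∧ P.Transmission lam y

variable (P) in
/-- `y` and `z` agree on the three closed subintervals. -/
def Agree (y z : PiecewiseFun) : Prop :=
  EqOn y.left z.left (Icc P.a P.ξ₁) ∧ EqOn y.mid z.mid (Icc P.ξ₁ P.ξ₂) ∧
    EqOn y.right z.right (Icc P.ξ₂ P.b)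

theorem left_mem_left : P.a ∈ Icc P.a P.ξ₁ := left_mem_Icc.2 P.a_lt.le
theorem right_mem_left : P.ξ₁ ∈ Icc P.a P.ξ₁ := right_mem_Icc.2 P.a_lt.le
theorem left_mem_mid : P.ξ₁ ∈ Icc P.ξ₁ P.ξ₂ := left_mem_Icc.2 P.ξ_lt.le
theorem right_mem_mid : P.ξ₂ ∈ Icc P.ξ₁ P.ξ₂ := right_mem_Icc.2 P.ξ_lt.le
theorem left_mem_right : P.ξ₂ ∈ Icc P.ξ₂ P.b := left_mem_Icc.2 P.lt_b.le
theorem right_mem_right : P.b ∈ Icc P.ξ₂ P.b := right_mem_Icc.2 P.lt_b.le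

theorem α₃_ne : (P.α₃ : ℂ) ≠ 0 := by exact_mod_cast P.α₃_pos.ne'
theorem α₅_ne : (P.α₅ : ℂ) ≠ 0 := by exact_mod_cast P.α₅_pos.ne'

theorem Agree.symm {y z : PiecewiseFun} (h : P.Agree y z) : P.Agree z y :=
  ⟨h.1.symm, h.2.1.symm, h.2.2.symm⟩

theorem Agree.trans {x y z : PiecewiseFun} (h : P.Agree x y) (h' : P.Agree y z) : P.Agree x z :=
  ⟨h.1.trans h'.1, h.2.1.trans h'.2.1, h.2.2.trans h'.2.2⟩

theorem IsSol.lincomb {lam : ℂ} {y z : PiecewiseFun} (hy : P.IsSol lam y) (hz : P.IsSol lam z)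
    (k l : ℂ) : P.IsSol lam (PiecewiseFun.lincomb k y l z) := by
  obtain ⟨⟨y1, y2, y3⟩, t1, t2, t3, t4⟩ := hy
  obtain ⟨⟨z1, z2, z3⟩, s1, s2, s3, s4⟩ := hz
  refine ⟨⟨y1.lincomb z1 k l, y2.lincomb z2 k l, y3.lincomb z3 k l⟩, ?_, ?_, ?_, ?_⟩ <;>
    simp only [PiecewiseFun.lincomb, Prod.fst_add, Prod.snd_add, Prod.smul_fst, Prod.smul_snd,
      smul_eq_mul]
  · linear_combination k * t1 + l * s1
  · linear_combination k * t2 + l * s2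
  · linear_combination k * t3 + l * s3
  · linear_combination k * t4 + l * s4

theorem IsSol.conj {lam : ℂ} {y : PiecewiseFun} (hy : P.IsSol lam y) :
    P.IsSol (star lam) y.conj := by
  obtain ⟨⟨y1, y2, y3⟩, t1, t2, t3, t4⟩ := hy
  refine ⟨⟨y1.conj, y2.conj, y3.conj⟩, ?_, ?_, ?_, ?_⟩
  · simpa [PiecewiseFun.conj] using congrArg (starRingEnd ℂ) t1
  · simpa [PiecewiseFun.conj] using congrArg (starRingEnd ℂ) t2
  · simpa [PiecewiseFun.conj] using congrArg (starRingEnd ℂ) t3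
  · simpa [PiecewiseFun.conj] using congrArg (starRingEnd ℂ) t4

variable (P) in
theorem exists_sol : ∃ S : ℂ → ℂ × ℂ → PiecewiseFun,
    (∀ lam v, P.IsSol lam (S lam v)) ∧ (∀ lam v, (S lam v).left P.a = v) ∧
    (∀ v : ℂ → ℂ × ℂ, Differentiable ℂ v →
      Differentiable ℂ (fun lam => (S lam (v lam)).left P.ξ₁) ∧
      Differentiable ℂ (fun lam => (S lam (v lam)).mid P.ξ₂) ∧
      Differentiable ℂ (fun lam => (S lam (v lam)).right P.b)) ∧
    (∀ v : ℂ → ℂ × ℂ, Differentiable ℂ v →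
      Continuous (fun p : ℂ × ℝ => (S p.1 (v p.1)).left p.2) ∧
      Continuous (fun p : ℂ × ℝ => (S p.1 (v p.1)).mid p.2) ∧
      Continuous (fun p : ℂ × ℝ => (S p.1 (v p.1)).right p.2)) ∧
    (∀ lam y, P.IsSol lam y → P.Agree y (S lam (y.left P.a))) := by
  obtain ⟨S₁, d₁, c₁, i₁, s₁, u₁⟩ := exists_solvesOn (P := P) P.ρ₁_pos P.a_lt.le le_rfl
    (P.ξ_lt.trans P.lt_b).le
  obtain ⟨S₂, d₂, c₂, i₂, s₂, u₂⟩ := exists_solvesOn (P := P) P.ρ₂_pos P.ξ_lt.le P.a_lt.le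
    P.lt_b.le
  obtain ⟨S₃, d₃, c₃, i₃, s₃, u₃⟩ := exists_solvesOn (P := P) P.ρ₃_pos P.lt_b.le
    (P.a_lt.trans P.ξ_lt).le le_rfl
  set T₁ : ℂ → ℂ × ℂ → ℂ × ℂ := fun lam v =>
    (P.α₃ * v.1, (P.α₄ + lam) * v.1 + (P.α₃ : ℂ)⁻¹ * v.2) with hT₁
  set T₂ : ℂ → ℂ × ℂ → ℂ × ℂ := fun lam v =>
    (P.α₅ * v.1, (P.α₆ + lam) * v.1 + (P.α₅ : ℂ)⁻¹ * v.2) with hT₂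
  have dT₁ : ∀ v : ℂ → ℂ × ℂ, Differentiable ℂ v → Differentiable ℂ fun lam => T₁ lam (v lam) := by
    intro v hv
    simp only [hT₁]
    fun_prop
  have dT₂ : ∀ v : ℂ → ℂ × ℂ, Differentiable ℂ v → Differentiable ℂ fun lam => T₂ lam (v lam) := by
    intro v hv
    simp only [hT₂]
    fun_prop
  have dm : ∀ v : ℂ → ℂ × ℂ, Differentiable ℂ v →
      Differentiable ℂ fun lam => T₁ lam (S₁ lam (v lam) P.ξ₁) := fun v hv => dT₁ _ (d₁ v hv _)
  have dr : ∀ v : ℂ → ℂ × ℂ, Differentiable ℂ v → Differentiable ℂ fun lam =>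
      T₂ lam (S₂ lam (T₁ lam (S₁ lam (v lam) P.ξ₁)) P.ξ₂) := fun v hv => dT₂ _ (d₂ _ (dm v hv) _)
  refine ⟨fun lam v => ⟨S₁ lam v, S₂ lam (T₁ lam (S₁ lam v P.ξ₁)),
    S₃ lam (T₂ lam (S₂ lam (T₁ lam (S₁ lam v P.ξ₁)) P.ξ₂))⟩, fun lam v => ?_, fun lam v => ?_,
    fun v hv => ?_, fun v hv => ?_, fun lam y hy => ?_⟩
  · refine ⟨⟨s₁ _ _, s₂ _ _, s₃ _ _⟩, ?_, ?_, ?_, ?_⟩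
    · simp [i₂, hT₁]
    · simp [i₂, hT₁]
    · simp [i₃, hT₂]
    · simp [i₃, hT₂]
  · exact i₁ _ _
  · exact ⟨d₁ v hv _, d₂ _ (dm v hv) _, d₃ _ (dr v hv) _⟩
  · exact ⟨c₁ v hv.continuous, c₂ _ (dm v hv).continuous, c₃ _ (dr v hv).continuous⟩
  · obtain ⟨⟨y1, y2, y3⟩, t1, t2, t3, t4⟩ := hy
    have e1 := u₁ lam _ y1
    have e2 := u₂ lam _ y2
    have e3 := u₃ lam _ y3
    have m1 : y.mid P.ξ₁ = T₁ lam (S₁ lam (y.left P.a) P.ξ₁) := by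
      rw [← e1 right_mem_left]
      ext
      · simp only [hT₁]; linear_combination t1
      · simp only [hT₁]; linear_combination t2
    rw [m1] at e2
    have m2 : y.right P.ξ₂ = T₂ lam (S₂ lam (T₁ lam (S₁ lam (y.left P.a) P.ξ₁)) P.ξ₂) := by
      rw [← e2 right_mem_mid]
      ext
      · simp only [hT₂]; linear_combination t3
      · simp only [hT₂]; linear_combination t4
    rw [m2] at e3
    exact ⟨e1, e2, e3⟩

variable (P) in
/-- The solution of the differential equation and the transmission conditions with the
value `v` at `a`. -/
noncomputable def sol : ℂ → ℂ × ℂ → PiecewiseFun := Classical.choose P.exists_sol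

variable (P) in
theorem isSol_sol (lam : ℂ) (v : ℂ × ℂ) : P.IsSol lam (P.sol lam v) :=
  (Classical.choose_spec P.exists_sol).1 lam v

variable (P) in
theorem sol_left_a (lam : ℂ) (v : ℂ × ℂ) : (P.sol lam v).left P.a = v :=
  (Classical.choose_spec P.exists_sol).2.1 lam v

theorem differentiable_sol {v : ℂ → ℂ × ℂ} (hv : Differentiable ℂ v) :
    Differentiable ℂ (fun lam => (P.sol lam (v lam)).left P.ξ₁) ∧
      Differentiable ℂ (fun lam => (P.sol lam (v lam)).mid P.ξ₂) ∧
      Differentiable ℂ (fun lam => (P.sol lam (v lam)).right P.b) :=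
  (Classical.choose_spec P.exists_sol).2.2.1 v hv

theorem continuous_sol {v : ℂ → ℂ × ℂ} (hv : Differentiable ℂ v) :
    Continuous (fun p : ℂ × ℝ => (P.sol p.1 (v p.1)).left p.2) ∧
      Continuous (fun p : ℂ × ℝ => (P.sol p.1 (v p.1)).mid p.2) ∧
      Continuous (fun p : ℂ × ℝ => (P.sol p.1 (v p.1)).right p.2) :=
  (Classical.choose_spec P.exists_sol).2.2.2.1 v hv

theorem IsSol.agree_sol {lam : ℂ} {y : PiecewiseFun} (hy : P.IsSol lam y) :
    P.Agree y (P.sol lam (y.left P.a)) :=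
  (Classical.choose_spec P.exists_sol).2.2.2.2 lam y hy

theorem IsSol.agree {lam : ℂ} {y z : PiecewiseFun} (hy : P.IsSol lam y) (hz : P.IsSol lam z)
    (h : y.left P.a = z.left P.a) : P.Agree y z := by
  have h1 := hy.agree_sol
  rw [h] at h1
  exact h1.trans hz.agree_sol.symm

variable (P) in
/-- The symmetric bilinear form that appears in Lagrange's identity. -/
noncomputable def form (y z : PiecewiseFun) : ℂ :=
  P.ρ₁ * (∫ x in P.a..P.ξ₁, ((y.left x).1 * (z.left x).1 + (y.left x).2 * (z.left x).2))
  + P.ρ₂ * (∫ x in P.ξ₁..P.ξ₂, ((y.mid x).1 * (z.mid x).1 + (y.mid x).2 * (z.mid x).2))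
  + P.ρ₃ * (∫ x in P.ξ₂..P.b, ((y.right x).1 * (z.right x).1 + (y.right x).2 * (z.right x).2))
  + P.α₃ * ((y.left P.ξ₁).1 * (z.left P.ξ₁).1)
  + P.α₅ * ((y.mid P.ξ₂).1 * (z.mid P.ξ₂).1)

theorem form_congr {y z y' z' : PiecewiseFun} (hy : P.Agree y y') (hz : P.Agree z z') :
    P.form y z = P.form y' z' := by
  have e1 : ∫ x in P.a..P.ξ₁, ((y.left x).1 * (z.left x).1 + (y.left x).2 * (z.left x).2) =
      ∫ x in P.a..P.ξ₁, ((y'.left x).1 * (z'.left x).1 + (y'.left x).2 * (z'.left x).2) :=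
    intervalIntegral.integral_congr fun x hx => by
      rw [uIcc_of_le P.a_lt.le] at hx; simp only [hy.1 hx, hz.1 hx]
  have e2 : ∫ x in P.ξ₁..P.ξ₂, ((y.mid x).1 * (z.mid x).1 + (y.mid x).2 * (z.mid x).2) =
      ∫ x in P.ξ₁..P.ξ₂, ((y'.mid x).1 * (z'.mid x).1 + (y'.mid x).2 * (z'.mid x).2) :=
    intervalIntegral.integral_congr fun x hx => by
      rw [uIcc_of_le P.ξ_lt.le] at hx; simp only [hy.2.1 hx, hz.2.1 hx]
  have e3 : ∫ x in P.ξ₂..P.b, ((y.right x).1 * (z.right x).1 + (y.right x).2 * (z.right x).2) =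
      ∫ x in P.ξ₂..P.b, ((y'.right x).1 * (z'.right x).1 + (y'.right x).2 * (z'.right x).2) :=
    intervalIntegral.integral_congr fun x hx => by
      rw [uIcc_of_le P.lt_b.le] at hx; simp only [hy.2.2 hx, hz.2.2 hx]
  rw [form, form, e1, e2, e3, hy.1 right_mem_left, hz.1 right_mem_left, hy.2.1 right_mem_mid,
    hz.2.1 right_mem_mid]

/-- Lagrange's identity. -/
theorem IsSol.wronskian_sub {lam mu : ℂ} {y z : PiecewiseFun} (hy : P.IsSol lam y)
    (hz : P.IsSol mu z) :
    wronskian (y.right P.b) (z.right P.b) - wronskian (y.left P.a) (z.left P.a) =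
      (mu - lam) * P.form y z := by
  obtain ⟨⟨y1, y2, y3⟩, t1, t2, t3, t4⟩ := hy
  obtain ⟨⟨z1, z2, z3⟩, s1, s2, s3, s4⟩ := hz
  have h1 := y1.wronskian_sub P.ρ₁_pos P.a_lt.le z1 left_mem_left right_mem_left
  have h2 := y2.wronskian_sub P.ρ₂_pos P.ξ_lt.le z2 left_mem_mid right_mem_mid
  have h3 := y3.wronskian_sub P.ρ₃_pos P.lt_b.le z3 left_mem_right right_mem_right
  -- The transmission matrix has determinant `1`, so the Wronskian jumps only through the different
  -- parameters in its lower left entry.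
  have j1 : wronskian (y.mid P.ξ₁) (z.mid P.ξ₁) - wronskian (y.left P.ξ₁) (z.left P.ξ₁) =
      (mu - lam) * (P.α₃ * ((y.left P.ξ₁).1 * (z.left P.ξ₁).1)) := by
    have := α₃_ne (P := P)
    simp only [wronskian]
    rw [sub_eq_zero.1 t1, sub_eq_zero.1 s1, sub_eq_iff_eq_add'.1 (sub_eq_zero.1 t2),
      sub_eq_iff_eq_add'.1 (sub_eq_zero.1 s2)]
    field_simp
    ring
  have j2 : wronskian (y.right P.ξ₂) (z.right P.ξ₂) - wronskian (y.mid P.ξ₂) (z.mid P.ξ₂) =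
      (mu - lam) * (P.α₅ * ((y.mid P.ξ₂).1 * (z.mid P.ξ₂).1)) := by
    have := α₅_ne (P := P)
    simp only [wronskian]
    rw [sub_eq_zero.1 t3, sub_eq_zero.1 s3, sub_eq_iff_eq_add'.1 (sub_eq_zero.1 t4),
      sub_eq_iff_eq_add'.1 (sub_eq_zero.1 s4)]
    field_simp
    ring
  rw [form]
  linear_combination h1 + h2 + h3 + j1 + j2

theorem IsSol.wronskian_eq {lam : ℂ} {y z : PiecewiseFun} (hy : P.IsSol lam y)
    (hz : P.IsSol lam z) :
    wronskian (y.right P.b) (z.right P.b) = wronskian (y.left P.a) (z.left P.a) := by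
  have := hy.wronskian_sub hz
  rwa [sub_self, zero_mul, sub_eq_zero] at this

/-- The solutions starting from the two unit vectors keep Wronskian `1` up to `b`, so Cramer's rule
gives the combination with value `w`. This is how `ψ` is obtained from solutions started at `a`. -/
theorem exists_isSol_right_b (lam : ℂ) (w : ℂ × ℂ) :
    ∃ y, P.IsSol lam y ∧ y.right P.b = w := by
  set y₁ := P.sol lam (1, 0)
  set y₂ := P.sol lam (0, 1)
  have hW : wronskian (y₁.right P.b) (y₂.right P.b) = 1 := by
    rw [(P.isSol_sol lam _).wronskian_eq (P.isSol_sol lam _), sol_left_a, sol_left_a]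
    simp [wronskian]
  refine ⟨PiecewiseFun.lincomb (wronskian w (y₂.right P.b)) y₁ (wronskian (y₁.right P.b) w) y₂,
    (P.isSol_sol lam _).lincomb (P.isSol_sol lam _) _ _, ?_⟩
  simp only [wronskian] at hW
  ext
  · simp only [PiecewiseFun.lincomb, wronskian, Prod.fst_add, Prod.smul_fst, smul_eq_mul]
    linear_combination w.1 * hW
  · simp only [PiecewiseFun.lincomb, wronskian, Prod.snd_add, Prod.smul_snd, smul_eq_mul]
    linear_combination w.2 * hW

end DiracProblem

/-! ### The functions `φ`, `ψ` and `Δ`; eigenvalues as zeros of `Δ` -/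

namespace DiracProblem

variable (P : DiracProblem)

/-- The initial value of `φ(·, lam)` at `a`. -/
noncomputable def phiInit (lam : ℂ) : ℂ × ℂ := (lam * P.α₂' - P.α₂, lam * P.α₁' - P.α₁)

/-- The terminal value of `ψ(·, lam)` at `b`. -/
noncomputable def psiEnd (lam : ℂ) : ℂ × ℂ := (lam * P.γ₂' + P.γ₂, lam * P.γ₁' + P.γ₁)

/-- `R'(ψ(·, lam)) = α₁' ψ₁(a, lam) - α₂' ψ₂(a, lam)`. -/
noncomputable def weylNum (lam : ℂ) : ℂ :=
  P.α₁' * ((P.psi lam).left P.a).1 - P.α₂' * ((P.psi lam).left P.a).2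

variable {P}

theorem d₁_pos' : 0 < P.d₁ := P.d₁_pos

theorem d₂_pos' : 0 < P.d₂ := P.d₂_pos

theorem d₁_ne : (P.d₁ : ℂ) ≠ 0 := by exact_mod_cast P.d₁_pos'.ne'

theorem d₂_ne : (P.d₂ : ℂ) ≠ 0 := by exact_mod_cast P.d₂_pos'.ne'

theorem d₁_eq : (P.d₁ : ℂ) = P.α₁ * P.α₂' - P.α₁' * P.α₂ := by simp [d₁]

theorem d₂_eq : (P.d₂ : ℂ) = P.γ₁ * P.γ₂' - P.γ₁' * P.γ₂ := by simp [d₂]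

theorem differentiable_phiInit : Differentiable ℂ P.phiInit := by
  unfold phiInit
  fun_prop

theorem differentiable_psiEnd : Differentiable ℂ P.psiEnd := by
  unfold psiEnd
  fun_prop

theorem phiInit_ne_zero (lam : ℂ) : P.phiInit lam ≠ 0 := by
  intro h
  have h1 : lam * P.α₂' - P.α₂ = 0 := congrArg Prod.fst h
  have h2 : lam * P.α₁' - P.α₁ = 0 := congrArg Prod.snd h
  apply P.d₁_ne
  rw [d₁_eq]
  linear_combination P.α₁' * h1 - P.α₂' * h2

theorem psiEnd_ne_zero (lam : ℂ) : P.psiEnd lam ≠ 0 := by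
  intro h
  have h1 : lam * P.γ₂' + P.γ₂ = 0 := congrArg Prod.fst h
  have h2 : lam * P.γ₁' + P.γ₁ = 0 := congrArg Prod.snd h
  apply P.d₂_ne
  rw [d₂_eq]
  linear_combination P.γ₂' * h2 - P.γ₁' * h1

variable (P)

theorem isPhi_phi (lam : ℂ) : P.IsPhi lam (P.phi lam) :=
  Classical.epsilon_spec (p := P.IsPhi lam)
    ⟨P.sol lam (P.phiInit lam), (P.isSol_sol lam _).1, P.sol_left_a lam _, (P.isSol_sol lam _).2⟩

theorem isSol_phi (lam : ℂ) : P.IsSol lam (P.phi lam) :=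
  ⟨(P.isPhi_phi lam).1, (P.isPhi_phi lam).2.2⟩

theorem phi_left_a (lam : ℂ) : (P.phi lam).left P.a = P.phiInit lam := (P.isPhi_phi lam).2.1

theorem isPsi_psi (lam : ℂ) : P.IsPsi lam (P.psi lam) := by
  refine Classical.epsilon_spec (p := P.IsPsi lam) ?_
  obtain ⟨y, ⟨hy, t1, t2, t3, t4⟩, hb⟩ := P.exists_isSol_right_b lam (P.psiEnd lam)
  have h3 := P.α₃_ne
  have h5 := P.α₅_ne
  rw [sub_eq_zero] at t1 t3
  rw [sub_eq_zero, sub_eq_iff_eq_add'] at t2 t4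
  refine ⟨y, hy, hb, ?_, ?_⟩
  · ext
    · simp only [t3]; field_simp
    · simp only [t3, t4]; field_simp; ring
  · ext
    · simp only [t1]; field_simp
    · simp only [t1, t2]; field_simp; ring

theorem isSol_psi (lam : ℂ) : P.IsSol lam (P.psi lam) := by
  obtain ⟨hy, -, h1, h2⟩ := P.isPsi_psi lam
  have h3 := P.α₃_ne
  have h5 := P.α₅_ne
  refine ⟨hy, ?_, ?_, ?_, ?_⟩
  · rw [h2]; field_simp; ring
  · rw [h2]; field_simp; ring
  · rw [h1]; field_simp; ring
  · rw [h1]; field_simp; ring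

theorem psi_right_b (lam : ℂ) : (P.psi lam).right P.b = P.psiEnd lam := (P.isPsi_psi lam).2.1

theorem phi_agree (lam : ℂ) : P.Agree (P.phi lam) (P.sol lam (P.phiInit lam)) := by
  rw [← phi_left_a]
  exact (P.isSol_phi lam).agree_sol

theorem differentiable_phi_right_b : Differentiable ℂ fun lam => (P.phi lam).right P.b := by
  have : (fun lam => (P.phi lam).right P.b) = fun lam => (P.sol lam (P.phiInit lam)).right P.b :=
    funext fun lam => (P.phi_agree lam).2.2 right_mem_right
  rw [this]
  exact (differentiable_sol (P := P) differentiable_phiInit).2.2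

theorem charFun_eq (lam : ℂ) :
    P.charFun lam = wronskian ((P.phi lam).right P.b) (P.psiEnd lam) := by
  rw [charFun, psi_right_b]

theorem charFun_eq_left (lam : ℂ) :
    P.charFun lam = wronskian (P.phiInit lam) ((P.psi lam).left P.a) := by
  rw [charFun, (P.isSol_phi lam).wronskian_eq (P.isSol_psi lam), phi_left_a]

theorem differentiable_charFun : Differentiable ℂ P.charFun := by
  have h1 := P.differentiable_phi_right_b
  have h2 := P.differentiable_psiEnd
  have : P.charFun = fun lam => wronskian ((P.phi lam).right P.b) (P.psiEnd lam) :=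
    funext P.charFun_eq
  rw [this]
  exact (h1.fst.mul h2.snd).sub (h1.snd.mul h2.fst)

theorem wronskian_psi_left_a (lam : ℂ) (v : ℂ × ℂ) :
    wronskian ((P.psi lam).left P.a) v = wronskian (P.psiEnd lam) ((P.sol lam v).right P.b) := by
  have h := (P.isSol_psi lam).wronskian_eq (P.isSol_sol lam v)
  rw [psi_right_b, sol_left_a] at h
  exact h.symm

/-- As `ψ` is prescribed at `b`, its values at `a` are recovered from Wronskians with solutions
started at `a`; these are constant and can be evaluated at `b`, where all data are holomorphic. -/
theorem differentiable_weylNum : Differentiable ℂ P.weylNum := by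
  have h1 : ∀ v, Differentiable ℂ fun lam => wronskian ((P.psi lam).left P.a) v := by
    intro v
    simp only [wronskian_psi_left_a]
    have h2 := P.differentiable_psiEnd
    have h3 := (differentiable_sol (P := P) (differentiable_const v)).2.2
    exact (h2.fst.mul h3.snd).sub (h2.snd.mul h3.fst)
  have : P.weylNum = fun lam => P.α₁' * wronskian ((P.psi lam).left P.a) (0, 1) +
      P.α₂' * wronskian ((P.psi lam).left P.a) (1, 0) := by
    ext lam
    simp [weylNum, wronskian]
    ring
  rw [this]
  exact ((h1 (0, 1)).const_mul _).add ((h1 (1, 0)).const_mul _)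

theorem weylFun_eq (lam : ℂ) : P.weylFun lam = (P.weylNum lam / P.d₁) / P.charFun lam := by
  rw [weylFun, weylNum, div_div]

variable {P}

theorem nontrivial_of_left_a_ne_zero {y : PiecewiseFun} (h : y.left P.a ≠ 0) : P.Nontrivial y :=
  Or.inl ⟨P.a, left_mem_Ico.2 P.a_lt, h⟩

theorem IsSol.left_a_ne_zero {lam : ℂ} {y : PiecewiseFun} (hy : P.IsSol lam y)
    (h : P.Nontrivial y) : y.left P.a ≠ 0 := by
  intro h0
  have h1 := hy.agree (hy.lincomb hy 0 0) (by simp [PiecewiseFun.lincomb, h0])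
  rcases h with ⟨x, hx, hne⟩ | ⟨x, hx, hne⟩ | ⟨x, hx, hne⟩
  · exact hne ((h1.1 (Ico_subset_Icc_self hx)).trans (by simp [PiecewiseFun.lincomb]))
  · exact hne ((h1.2.1 (Ioo_subset_Icc_self hx)).trans (by simp [PiecewiseFun.lincomb]))
  · exact hne ((h1.2.2 (Ioc_subset_Icc_self hx)).trans (by simp [PiecewiseFun.lincomb]))

theorem exists_eq_smul_of_wronskian_eq_zero {v w : ℂ × ℂ} (hv : v ≠ 0) (h : wronskian v w = 0) :
    ∃ k : ℂ, w = k • v := by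
  rw [wronskian, sub_eq_zero] at h
  by_cases h1 : v.1 = 0
  · have h2 : v.2 ≠ 0 := fun h2 => hv (Prod.ext h1 h2)
    refine ⟨w.2 / v.2, Prod.ext ?_ ?_⟩
    · rw [h1, zero_mul, eq_comm, mul_eq_zero] at h
      simp [h1, h.resolve_left h2]
    · simp [h2]
  · refine ⟨w.1 / v.1, Prod.ext ?_ ?_⟩
    · simp [h1]
    · simp only [Prod.smul_snd, smul_eq_mul]
      field_simp
      linear_combination h

/-- The condition at `a` says that `y(a)` is parallel to `φ(a)`, and the condition at `b` that `W(y,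
ψ)` vanishes there. -/
theorem mem_eigenvalues_iff {lam : ℂ} : lam ∈ P.eigenvalues ↔ P.charFun lam = 0 := by
  constructor
  · rintro ⟨y, hy, hl, hr, ht, hn⟩
    have hs : P.IsSol lam y := ⟨hy, ht⟩
    have h0 := hs.left_a_ne_zero hn
    obtain ⟨k, hk⟩ := exists_eq_smul_of_wronskian_eq_zero (P.phiInit_ne_zero lam)
      (w := y.left P.a) (by
        unfold BoundaryLeft at hl
        simp only [wronskian, phiInit]
        linear_combination -hl)
    have hk0 : k ≠ 0 := fun h => h0 (by rw [hk, h, zero_smul])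
    have hag := hs.agree ((P.isSol_phi lam).lincomb (P.isSol_phi lam) k 0)
      (by simp [PiecewiseFun.lincomb, phi_left_a, hk])
    have hb : y.right P.b = k • (P.phi lam).right P.b := by
      rw [hag.2.2 right_mem_right]; simp [PiecewiseFun.lincomb]
    have : k * P.charFun lam = 0 := by
      rw [charFun_eq, ← wronskian_smul_left, ← hb]
      unfold BoundaryRight at hr
      simp only [wronskian, psiEnd]
      linear_combination hr
    exact (mul_eq_zero.1 this).resolve_left hk0
  · intro h
    refine ⟨P.phi lam, (P.isSol_phi lam).1, ?_, ?_, (P.isSol_phi lam).2,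
      nontrivial_of_left_a_ne_zero (by rw [phi_left_a]; exact P.phiInit_ne_zero lam)⟩
    · rw [BoundaryLeft, phi_left_a]
      simp only [phiInit]
      ring
    · rw [charFun_eq] at h
      simp only [wronskian, psiEnd] at h
      unfold BoundaryRight
      linear_combination h

theorem exists_psi_agree_smul_phi {lam : ℂ} (h : P.charFun lam = 0) :
    ∃ k : ℂ, k ≠ 0 ∧ P.Agree (P.psi lam) (PiecewiseFun.lincomb k (P.phi lam) 0 (P.phi lam)) := by
  rw [charFun_eq_left] at h
  obtain ⟨k, hk⟩ := exists_eq_smul_of_wronskian_eq_zero (P.phiInit_ne_zero lam) h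
  have hag := (P.isSol_psi lam).agree ((P.isSol_phi lam).lincomb (P.isSol_phi lam) k 0)
    (by simp [PiecewiseFun.lincomb, phi_left_a, hk])
  refine ⟨k, ?_, hag⟩
  rintro rfl
  have := hag.2.2 right_mem_right
  rw [psi_right_b] at this
  exact P.psiEnd_ne_zero lam (this.trans (by simp [PiecewiseFun.lincomb]))

end DiracProblem

/-! ### Lower bounds for `Δ` off the real axis -/

/-- A function that grows to the left at least at the rate `k` grows exponentially. -/
theorem exp_mul_le_add_integral {f : ℝ → ℝ} (hf : Continuous f) {ρ k g c b : ℝ} (hcb : c ≤ b)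
    (h : ∀ x ∈ Icc c b, k * (g + ρ * ∫ t in x..b, f t) ≤ ρ * f x) :
    g * Real.exp (k * (b - c)) ≤ g + ρ * ∫ t in c..b, f t := by
  set G : ℝ → ℝ := fun x => g + ρ * ∫ t in x..b, f t with hG
  have hGd : ∀ x, HasDerivAt G (-(ρ * f x)) x := fun x => by
    have := ((intervalIntegral.integral_hasDerivAt_left (hf.intervalIntegrable x b)
      (hf.stronglyMeasurableAtFilter _ _) hf.continuousAt).const_mul ρ).const_add g
    simpa [hG] using this
  have hH : ∀ x, HasDerivAt (fun x => G x * Real.exp (k * x))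
      ((k * G x - ρ * f x) * Real.exp (k * x)) x := fun x => by
    convert! (hGd x).mul ((hasDerivAt_id x).const_mul k).exp using 1
    simp
    ring
  -- The hypothesis is the differential inequality `G' ≤ -k G`.
  have hanti : AntitoneOn (fun x => G x * Real.exp (k * x)) (Icc c b) := by
    refine antitoneOn_of_deriv_nonpos (convex_Icc c b)
      (fun x _ => (hH x).continuousAt.continuousWithinAt)
      (fun x _ => (hH x).differentiableAt.differentiableWithinAt) fun x hx => ?_
    rw [(hH x).deriv]
    refine mul_nonpos_of_nonpos_of_nonneg (sub_nonpos.2 (h x (interior_subset hx)))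
      (Real.exp_pos _).le
  have h1 := hanti (left_mem_Icc.2 hcb) (right_mem_Icc.2 hcb) hcb
  have hb : G b = g := by simp [hG]
  simp only [hb] at h1
  have h2 : g * Real.exp (k * (b - c)) * Real.exp (k * c) ≤ G c * Real.exp (k * c) := by
    rwa [mul_assoc, ← Real.exp_add, show k * (b - c) + k * c = k * b by ring]
  exact le_of_mul_le_mul_right h2 (Real.exp_pos _)

namespace DiracProblem

variable {P : DiracProblem}

theorem IsSol.continuousOn {lam : ℂ} {y : PiecewiseFun} (hy : P.IsSol lam y) :
    ContinuousOn y.left (Icc P.a P.ξ₁) ∧ ContinuousOn y.mid (Icc P.ξ₁ P.ξ₂) ∧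
      ContinuousOn y.right (Icc P.ξ₂ P.b) :=
  ⟨hy.1.1.continuousOn P.a_lt.le, hy.1.2.1.continuousOn P.ξ_lt.le,
    hy.1.2.2.continuousOn P.lt_b.le⟩

theorem integral_mul_star (y : ℝ → ℂ × ℂ) (c d : ℝ) :
    ∫ t in c..d, ((y t).1 * (star (y t)).1 + (y t).2 * (star (y t)).2) =
      ((∫ t in c..d, (‖(y t).1‖ ^ 2 + ‖(y t).2‖ ^ 2) : ℝ) : ℂ) := by
  rw [← intervalIntegral.integral_ofReal]
  refine intervalIntegral.integral_congr fun t _ => ?_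
  simp [Complex.mul_conj, Complex.normSq_eq_norm_sq]

/-- All weights are positive. The last bound retains the interval next to `b`, where the exponential
growth of `ψ` is measured. -/
theorem exists_form_conj (y : PiecewiseFun) : ∃ r : ℝ, P.form y y.conj = r ∧ 0 ≤ r ∧
    P.ρ₃ * ∫ t in P.ξ₂..P.b, (‖(y.right t).1‖ ^ 2 + ‖(y.right t).2‖ ^ 2) ≤ r := by
  have hnn : ∀ (u : ℝ → ℂ × ℂ) (c d : ℝ), c ≤ d →
      0 ≤ ∫ t in c..d, (‖(u t).1‖ ^ 2 + ‖(u t).2‖ ^ 2) := fun u c d hcd =>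
    intervalIntegral.integral_nonneg hcd fun _ _ => by positivity
  have h1 := mul_nonneg P.ρ₁_pos.le (hnn y.left P.a P.ξ₁ P.a_lt.le)
  have h2 := mul_nonneg P.ρ₂_pos.le (hnn y.mid P.ξ₁ P.ξ₂ P.ξ_lt.le)
  have h3 := mul_nonneg P.ρ₃_pos.le (hnn y.right P.ξ₂ P.b P.lt_b.le)
  have h4 := mul_nonneg P.α₃_pos.le (sq_nonneg ‖(y.left P.ξ₁).1‖)
  have h5 := mul_nonneg P.α₅_pos.le (sq_nonneg ‖(y.mid P.ξ₂).1‖)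
  refine ⟨P.ρ₁ * (∫ t in P.a..P.ξ₁, (‖(y.left t).1‖ ^ 2 + ‖(y.left t).2‖ ^ 2)) +
    P.ρ₂ * (∫ t in P.ξ₁..P.ξ₂, (‖(y.mid t).1‖ ^ 2 + ‖(y.mid t).2‖ ^ 2)) +
    P.ρ₃ * (∫ t in P.ξ₂..P.b, (‖(y.right t).1‖ ^ 2 + ‖(y.right t).2‖ ^ 2)) +
    P.α₃ * ‖(y.left P.ξ₁).1‖ ^ 2 + P.α₅ * ‖(y.mid P.ξ₂).1‖ ^ 2, ?_, by positivity, by linarith⟩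
  simp only [form, PiecewiseFun.conj, integral_mul_star]
  simp [Complex.mul_conj, Complex.normSq_eq_norm_sq]

theorem wronskian_psiEnd (lam mu : ℂ) :
    wronskian (P.psiEnd lam) (P.psiEnd mu) = (lam - mu) * P.d₂ := by
  rw [d₂_eq]
  simp only [wronskian, psiEnd]
  ring

theorem wronskian_phiInit (lam mu : ℂ) :
    wronskian (P.phiInit lam) (P.phiInit mu) = (mu - lam) * P.d₁ := by
  rw [d₁_eq]
  simp only [wronskian, phiInit]
  ring

theorem star_psiEnd (lam : ℂ) : star (P.psiEnd lam) = P.psiEnd (star lam) := by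
  ext <;> simp [psiEnd]

theorem star_phiInit (lam : ℂ) : star (P.phiInit lam) = P.phiInit (star lam) := by
  ext <;> simp [phiInit]

theorem norm_sub_star (z : ℂ) : ‖z - star z‖ = 2 * |z.im| := by
  rw [show star z = (starRingEnd ℂ) z from rfl, Complex.sub_conj]
  simp

/-- With `N = weylNum`, the imaginary part of `Δ` times the conjugate of `N` is `-Im λ · (d₁ (d₂ +
r) + |N|²)`. The terms `d₂` and `r` come from Lagrange's identity for `ψ` and its conjugate, `d₂`
being the boundary term at `b`; `|N|²` comes from the `λ` in `φ(a)`. -/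
theorem charFun_lower_bound (lam : ℂ) {r : ℝ} (hr : P.form (P.psi lam) (P.psi lam).conj = r)
    (hr0 : 0 ≤ r) :
    |lam.im| * (P.d₁ * (P.d₂ + r) + ‖P.weylNum lam‖ ^ 2) ≤ ‖P.charFun lam‖ * ‖P.weylNum lam‖ := by
  have h := (P.isSol_psi lam).wronskian_sub (P.isSol_psi lam).conj
  have hb : (P.psi lam).conj.right P.b = P.psiEnd (star lam) := by
    rw [← star_psiEnd, ← psi_right_b]; rfl
  have ha : (P.psi lam).conj.left P.a = star ((P.psi lam).left P.a) := rfl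
  rw [hb, psi_right_b, wronskian_psiEnd, hr, ha] at h
  have key : P.charFun lam * star (P.weylNum lam) - star (P.charFun lam * star (P.weylNum lam)) =
      -((lam - star lam) * ((P.d₁ * (P.d₂ + r) + ‖P.weylNum lam‖ ^ 2 : ℝ) : ℂ)) := by
    have h1 : ((‖P.weylNum lam‖ ^ 2 : ℝ) : ℂ) = P.weylNum lam * star (P.weylNum lam) := by
      rw [show star (P.weylNum lam) = (starRingEnd ℂ) (P.weylNum lam) from rfl, Complex.mul_conj,
        Complex.normSq_eq_norm_sq]
    rw [Complex.ofReal_add, h1, charFun_eq_left]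
    push_cast
    have hd := P.d₁_eq
    simp only [wronskian, weylNum, phiInit, Prod.fst_star, Prod.snd_star, star_sub, star_mul',
      Complex.conj_conj, Complex.star_def, Complex.conj_ofReal] at h ⊢
    linear_combination (P.d₁ : ℂ) * h + (((P.psi lam).left P.a).1 *
      (starRingEnd ℂ) ((P.psi lam).left P.a).2 - ((P.psi lam).left P.a).2 *
      (starRingEnd ℂ) ((P.psi lam).left P.a).1) * hd
  have h2 := congrArg norm key
  rw [norm_sub_star, norm_neg, norm_mul, norm_sub_star, Complex.norm_real, Real.norm_of_nonneg
    (add_nonneg (mul_nonneg P.d₁_pos'.le (add_nonneg P.d₂_pos'.le hr0)) (sq_nonneg _))] at h2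
  have h3 := Complex.abs_im_le_norm (P.charFun lam * star (P.weylNum lam))
  rw [norm_mul, norm_star] at h3
  linarith

theorem im_eq_zero_of_charFun_eq_zero {lam : ℂ} (h : P.charFun lam = 0) : lam.im = 0 := by
  obtain ⟨r, hr, hr0, -⟩ := P.exists_form_conj (P.psi lam)
  have h1 := charFun_lower_bound lam hr hr0
  rw [h, norm_zero, zero_mul] at h1
  have h2 : 0 < P.d₁ * (P.d₂ + r) + ‖P.weylNum lam‖ ^ 2 :=
    add_pos_of_pos_of_nonneg (mul_pos P.d₁_pos' (add_pos_of_pos_of_nonneg P.d₂_pos' hr0))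
      (sq_nonneg _)
  by_contra h3
  exact absurd (mul_pos (abs_pos.2 h3) h2) (not_lt.2 h1)

theorem norm_weylNum_mul_abs_im_le (lam : ℂ) :
    ‖P.weylNum lam‖ * |lam.im| ≤ ‖P.charFun lam‖ := by
  obtain ⟨r, hr, hr0, -⟩ := P.exists_form_conj (P.psi lam)
  have h1 := charFun_lower_bound lam hr hr0
  rcases (norm_nonneg (P.weylNum lam)).eq_or_lt with h0 | h0
  · rw [← h0, zero_mul]; exact norm_nonneg _
  · refine le_of_mul_le_mul_right (le_trans ?_ h1) h0
    have := mul_nonneg (abs_nonneg lam.im)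
      (mul_nonneg P.d₁_pos'.le (add_nonneg P.d₂_pos'.le hr0))
    nlinarith

theorem abs_im_mul_sqrt_le_charFun (lam : ℂ) {r : ℝ} (hr : P.form (P.psi lam) (P.psi lam).conj = r)
    (hr0 : 0 ≤ r) : |lam.im| * Real.sqrt (P.d₁ * (P.d₂ + r)) ≤ ‖P.charFun lam‖ := by
  have h1 := charFun_lower_bound lam hr hr0
  set s := Real.sqrt (P.d₁ * (P.d₂ + r))
  have hpos : 0 < P.d₁ * (P.d₂ + r) := mul_pos P.d₁_pos' (add_pos_of_pos_of_nonneg P.d₂_pos' hr0)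
  have hs : s ^ 2 = P.d₁ * (P.d₂ + r) := Real.sq_sqrt hpos.le
  have hs0 : 0 < s := Real.sqrt_pos.2 hpos
  rw [← hs] at h1
  set u := ‖P.weylNum lam‖
  have hu : 0 ≤ u := norm_nonneg _
  rcases hu.eq_or_lt with h0 | h0
  · rw [← h0] at h1
    have h2 : |lam.im| * s ^ 2 ≤ 0 := by simpa using h1
    have h3 : |lam.im| ≤ 0 := nonpos_of_mul_nonpos_left h2 (by positivity)
    exact (mul_nonpos_of_nonpos_of_nonneg h3 hs0.le).trans (norm_nonneg _)
  · refine le_of_mul_le_mul_right (le_trans ?_ h1) h0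
    rw [mul_assoc]
    refine mul_le_mul_of_nonneg_left ?_ (abs_nonneg _)
    -- Here `s u ≤ s² + u²`, by the arithmetic-geometric mean inequality.
    nlinarith [sq_nonneg (s - u), sq_nonneg s, sq_nonneg u]

theorem abs_im_le_charFun (lam : ℂ) :
    |lam.im| ≤ (Real.sqrt (P.d₁ * P.d₂))⁻¹ * ‖P.charFun lam‖ := by
  obtain ⟨r, hr, hr0, -⟩ := P.exists_form_conj (P.psi lam)
  have hpos : 0 < Real.sqrt (P.d₁ * P.d₂) := Real.sqrt_pos.2 (mul_pos P.d₁_pos' P.d₂_pos')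
  rw [inv_mul_eq_div, le_div_iff₀ hpos]
  refine le_trans (mul_le_mul_of_nonneg_left (Real.sqrt_le_sqrt ?_) (abs_nonneg _))
    (abs_im_mul_sqrt_le_charFun lam hr hr0)
  exact mul_le_mul_of_nonneg_left (by linarith) P.d₁_pos'.le

/-- Put `G(x) = d₂ + ρ₃ ∫ₓᵇ |ψ|²`. Lagrange's identity on `[x, b]` gives `|W(ψ, ψ̄)(x)| = 2 τ G(x)`,
while `|W(ψ, ψ̄)| ≤ |ψ|²`; so `G` grows to the left at rate `2 τ ρ₃`. The square root in
`abs_im_mul_sqrt_le_charFun` halves this rate. -/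
theorem exp_le_charFun {τ : ℝ} (hτ : 1 ≤ τ) :
    Real.sqrt (P.d₁ * P.d₂) * Real.exp (P.ρ₃ * (P.b - P.ξ₂) * τ) ≤
      ‖P.charFun (τ * Complex.I)‖ := by
  set lam : ℂ := τ * Complex.I with hlam
  have him : |lam.im| = τ := by simp [hlam]; linarith
  obtain ⟨r, hr, hr0, hr1⟩ := P.exists_form_conj (P.psi lam)
  set y := (P.psi lam).right with hy
  have hsol : P.SolvesOn P.ρ₃ P.ξ₂ P.b lam y := (P.isSol_psi lam).1.2.2
  have hcont := hsol.continuousOn P.lt_b.le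
  -- A constant extension beyond the interval makes the integrand continuous on all of `ℝ`.
  set F : ℝ → ℝ := IccExtend P.lt_b.le
    ((Icc P.ξ₂ P.b).domRestrict fun t => ‖(y t).1‖ ^ 2 + ‖(y t).2‖ ^ 2) with hF
  have hFc : Continuous F := by
    refine Continuous.Icc_extend' (ContinuousOn.domRestrict ?_)
    fun_prop
  have hFe : ∀ t ∈ Icc P.ξ₂ P.b, F t = ‖(y t).1‖ ^ 2 + ‖(y t).2‖ ^ 2 := fun t ht => by
    rw [hF, IccExtend_of_mem _ _ ht]; rfl
  have hFi : ∀ x ∈ Icc P.ξ₂ P.b, ∫ t in x..P.b, F t =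
      ∫ t in x..P.b, (‖(y t).1‖ ^ 2 + ‖(y t).2‖ ^ 2) := fun x hx =>
    intervalIntegral.integral_congr fun t ht => by
      rw [uIcc_of_le hx.2] at ht
      exact hFe t ⟨hx.1.trans ht.1, ht.2⟩
  have hgrow : ∀ x ∈ Icc P.ξ₂ P.b,
      (2 * τ * P.ρ₃) * (P.d₂ + P.ρ₃ * ∫ t in x..P.b, F t) ≤ P.ρ₃ * F x := by
    intro x hx
    have h := hsol.wronskian_sub P.ρ₃_pos P.lt_b.le hsol.conj hx right_mem_right
    have hb : y P.b = P.psiEnd lam := P.psi_right_b lam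
    rw [integral_mul_star, hb, star_psiEnd, wronskian_psiEnd, ← hFi x hx] at h
    have h1 : wronskian (y x) (star (y x)) =
        (lam - star lam) * ((P.d₂ + P.ρ₃ * ∫ t in x..P.b, F t : ℝ) : ℂ) := by
      push_cast
      linear_combination -h
    have hnn : 0 ≤ P.d₂ + P.ρ₃ * ∫ t in x..P.b, F t := by
      refine add_nonneg P.d₂_pos'.le (mul_nonneg P.ρ₃_pos.le ?_)
      rw [hFi x hx]
      exact intervalIntegral.integral_nonneg hx.2 fun _ _ => by positivity
    have h2 := congrArg norm h1
    rw [norm_mul, norm_sub_star, him, Complex.norm_real, Real.norm_of_nonneg hnn] at h2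
    have h3 : ‖wronskian (y x) (star (y x))‖ ≤ F x := by
      rw [hFe x hx, wronskian]
      refine (norm_sub_le _ _).trans ?_
      rw [norm_mul, norm_mul, Prod.fst_star, Prod.snd_star, norm_star, norm_star]
      nlinarith [sq_nonneg (‖(y x).1‖ - ‖(y x).2‖)]
    rw [h2] at h3
    have := mul_le_mul_of_nonneg_left h3 P.ρ₃_pos.le
    linarith
  have hexp := exp_mul_le_add_integral hFc P.lt_b.le hgrow
  rw [hFi _ left_mem_right] at hexp
  have hle : P.d₂ * Real.exp (2 * τ * P.ρ₃ * (P.b - P.ξ₂)) ≤ P.d₂ + r := by linarith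
  have h4 := abs_im_mul_sqrt_le_charFun lam hr hr0
  rw [him] at h4
  calc _ = Real.sqrt (P.d₁ * (P.d₂ * Real.exp (2 * τ * P.ρ₃ * (P.b - P.ξ₂)))) := by
        rw [← mul_assoc, Real.sqrt_mul (mul_pos P.d₁_pos' P.d₂_pos').le,
          show 2 * τ * P.ρ₃ * (P.b - P.ξ₂) = P.ρ₃ * (P.b - P.ξ₂) * τ + P.ρ₃ * (P.b - P.ξ₂) * τ by
            ring, Real.exp_add, Real.sqrt_mul_self (Real.exp_pos _).le]
    _ ≤ Real.sqrt (P.d₁ * (P.d₂ + r)) :=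
        Real.sqrt_le_sqrt (mul_le_mul_of_nonneg_left hle P.d₁_pos'.le)
    _ ≤ τ * Real.sqrt (P.d₁ * (P.d₂ + r)) := le_mul_of_one_le_left (Real.sqrt_nonneg _) hτ
    _ ≤ _ := h4

end DiracProblem

/-! ### Normalizing constants, orthogonality and Bessel's inequality -/

namespace PiecewiseFun

/-- The linear combination `∑ i ∈ s, c i y i`. -/
noncomputable def sum {ι : Type*} (s : Finset ι) (c : ι → ℂ) (y : ι → PiecewiseFun) :
    PiecewiseFun :=
  ⟨fun x => ∑ i ∈ s, c i • (y i).left x, fun x => ∑ i ∈ s, c i • (y i).mid x,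
    fun x => ∑ i ∈ s, c i • (y i).right x⟩

end PiecewiseFun

namespace DiracProblem

variable {P : DiracProblem}

variable (P) in
/-- `γ₁' y₁(b) - γ₂' y₂(b)` for `y = φ(·, lam)`. -/
noncomputable def endNum (lam : ℂ) : ℂ :=
  P.γ₁' * ((P.phi lam).right P.b).1 - P.γ₂' * ((P.phi lam).right P.b).2

theorem form_comm (y z : PiecewiseFun) : P.form y z = P.form z y := by
  simp only [form, mul_comm]

/-- The quantity `α₁' φ₁(a) - α₂' φ₂(a)` equals `d₁` for every `lam`, so its weighted square
contributes exactly `d₁`. -/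
theorem normConst_eq (lam : ℂ) :
    P.normConst lam = P.form (P.phi lam) (P.phi lam) + P.d₁ + (P.d₂ : ℂ)⁻¹ * P.endNum lam ^ 2 := by
  have h : (P.α₁' : ℂ) * ((P.phi lam).left P.a).1 - P.α₂' * ((P.phi lam).left P.a).2 = P.d₁ := by
    rw [phi_left_a, d₁_eq]
    simp only [phiInit]
    ring
  have := P.d₁_ne
  rw [normConst, h, form, endNum]
  simp only [sq]
  field_simp

theorem intervalIntegrable_mul_add_mul {y z : ℝ → ℂ × ℂ} {c d : ℝ} (hcd : c ≤ d)
    (hy : ContinuousOn y (Icc c d)) (hz : ContinuousOn z (Icc c d)) :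
    IntervalIntegrable (fun x => (y x).1 * (z x).1 + (y x).2 * (z x).2) volume c d := by
  rw [← uIcc_of_le hcd] at hy hz
  exact ContinuousOn.intervalIntegrable (by fun_prop)

theorem integral_sum_mul {ι : Type*} (s : Finset ι) (k : ι → ℂ) {y : ι → ℝ → ℂ × ℂ}
    {z : ℝ → ℂ × ℂ} {c d : ℝ} (hcd : c ≤ d) (hy : ∀ i ∈ s, ContinuousOn (y i) (Icc c d))
    (hz : ContinuousOn z (Icc c d)) :
    ∫ x in c..d, ((∑ i ∈ s, k i • y i x).1 * (z x).1 + (∑ i ∈ s, k i • y i x).2 * (z x).2) =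
      ∑ i ∈ s, k i * ∫ x in c..d, ((y i x).1 * (z x).1 + (y i x).2 * (z x).2) := by
  simp_rw [← intervalIntegral.integral_const_mul]
  rw [← intervalIntegral.integral_finsetSum fun i hi =>
    (intervalIntegrable_mul_add_mul hcd (hy i hi) hz).const_mul (k i)]
  refine intervalIntegral.integral_congr fun x _ => ?_
  simp only [Prod.fst_sum, Prod.snd_sum, Prod.smul_fst, Prod.smul_snd, smul_eq_mul,
    Finset.sum_mul, ← Finset.sum_add_distrib]
  exact Finset.sum_congr rfl fun i _ => by ring

variable (P) in
/-- The three pieces are continuous on the closed subintervals. -/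
def PiecewiseContinuous (y : PiecewiseFun) : Prop :=
  ContinuousOn y.left (Icc P.a P.ξ₁) ∧ ContinuousOn y.mid (Icc P.ξ₁ P.ξ₂) ∧
    ContinuousOn y.right (Icc P.ξ₂ P.b)

theorem PiecewiseContinuous.sum {ι : Type*} {s : Finset ι} {k : ι → ℂ} {y : ι → PiecewiseFun}
    (hy : ∀ i ∈ s, P.PiecewiseContinuous (y i)) :
    P.PiecewiseContinuous (PiecewiseFun.sum s k y) :=
  ⟨continuousOn_finsetSum s fun i hi => (hy i hi).1.const_smul (k i),
    continuousOn_finsetSum s fun i hi => (hy i hi).2.1.const_smul (k i),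
    continuousOn_finsetSum s fun i hi => (hy i hi).2.2.const_smul (k i)⟩

theorem form_sum {ι : Type*} {s : Finset ι} {k : ι → ℂ} {y : ι → PiecewiseFun} {z : PiecewiseFun}
    (hy : ∀ i ∈ s, P.PiecewiseContinuous (y i)) (hz : P.PiecewiseContinuous z) :
    P.form (PiecewiseFun.sum s k y) z = ∑ i ∈ s, k i * P.form (y i) z := by
  simp only [form, PiecewiseFun.sum]
  rw [integral_sum_mul s k P.a_lt.le (fun i hi => (hy i hi).1) hz.1,
    integral_sum_mul s k P.ξ_lt.le (fun i hi => (hy i hi).2.1) hz.2.1,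
    integral_sum_mul s k P.lt_b.le (fun i hi => (hy i hi).2.2) hz.2.2]
  simp only [Prod.fst_sum, Prod.smul_fst, smul_eq_mul, Finset.sum_mul, Finset.mul_sum,
    ← Finset.sum_add_distrib]
  exact Finset.sum_congr rfl fun i _ => by ring

theorem star_eq_of_im_eq_zero {z : ℂ} (h : z.im = 0) : star z = z := by
  rw [Complex.star_def, Complex.conj_eq_iff_im]; exact h

theorem phi_conj_agree {lam : ℂ} (h : lam.im = 0) : P.Agree (P.phi lam).conj (P.phi lam) := by
  have h1 := (P.isSol_phi lam).conj
  rw [star_eq_of_im_eq_zero h] at h1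
  refine h1.agree (P.isSol_phi lam) ?_
  change star ((P.phi lam).left P.a) = _
  rw [phi_left_a, star_phiInit, star_eq_of_im_eq_zero h]

theorem endNum_im {lam : ℂ} (h : lam.im = 0) : (P.endNum lam).im = 0 := by
  have h1 : star ((P.phi lam).right P.b) = (P.phi lam).right P.b :=
    (P.phi_conj_agree h).2.2 right_mem_right
  rw [← Complex.conj_eq_iff_im, endNum]
  have e1 := congrArg Prod.fst h1
  have e2 := congrArg Prod.snd h1
  simp only [Prod.fst_star, Prod.snd_star, Complex.star_def] at e1 e2
  simp [e1, e2]

theorem exists_normConst_eq {lam : ℂ} (h : lam.im = 0) :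
    ∃ m : ℝ, 0 < m ∧ P.normConst lam = m := by
  obtain ⟨r, hr, hr0, -⟩ := P.exists_form_conj (P.phi lam)
  rw [form_congr ⟨fun _ _ => rfl, fun _ _ => rfl, fun _ _ => rfl⟩ (P.phi_conj_agree h)] at hr
  refine ⟨r + P.d₁ + P.d₂⁻¹ * (P.endNum lam).re ^ 2, ?_, ?_⟩
  · have h1 := P.d₁_pos'
    have h2 := inv_pos.2 P.d₂_pos'
    positivity
  · rw [normConst_eq, hr]
    have : P.endNum lam = ((P.endNum lam).re : ℂ) :=
      Complex.ext (by simp) (by simp [endNum_im h])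
    rw [this]
    push_cast
    simp

/-- Orthogonality of eigenvectors, with the components from the two boundary conditions moved to the
right. At `b` each `φ` is a multiple of `ψ`, so the Wronskian there reduces to that of the explicit
end values. -/
theorem form_phi_phi {lam mu : ℂ} (hl : P.charFun lam = 0) (hm : P.charFun mu = 0)
    (hne : lam ≠ mu) :
    P.form (P.phi lam) (P.phi mu) = -(P.d₁ + (P.d₂ : ℂ)⁻¹ * (P.endNum lam * P.endNum mu)) := by
  have aux : ∀ {nu : ℂ}, P.charFun nu = 0 →
      ∃ k : ℂ, k ≠ 0 ∧ P.psiEnd nu = k • (P.phi nu).right P.b ∧ k * P.endNum nu = -P.d₂ := by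
    intro nu hnu
    obtain ⟨k, hk, hag⟩ := exists_psi_agree_smul_phi hnu
    have h1 : P.psiEnd nu = k • (P.phi nu).right P.b := by
      rw [← psi_right_b, hag.2.2 right_mem_right]; simp [PiecewiseFun.lincomb]
    refine ⟨k, hk, h1, ?_⟩
    have e1 := congrArg Prod.fst h1
    have e2 := congrArg Prod.snd h1
    simp only [psiEnd, Prod.smul_fst, Prod.smul_snd, smul_eq_mul] at e1 e2
    rw [endNum, d₂_eq]
    linear_combination (P.γ₂' : ℂ) * e2 - P.γ₁' * e1
  obtain ⟨k, hk, hk1, hk2⟩ := aux hl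
  obtain ⟨l, hl0, hl1, hl2⟩ := aux hm
  have h := (P.isSol_phi lam).wronskian_sub (P.isSol_phi mu)
  rw [phi_left_a, phi_left_a, wronskian_phiInit] at h
  have h1 := P.wronskian_psiEnd lam mu
  rw [hk1, hl1, wronskian_smul_left, wronskian_smul_right] at h1
  have hsub : mu - lam ≠ 0 := sub_ne_zero.2 hne.symm
  have hd := P.d₂_ne
  have e1 : P.endNum lam = -P.d₂ / k := by rw [eq_div_iff hk]; linear_combination hk2
  have e2 : P.endNum mu = -P.d₂ / l := by rw [eq_div_iff hl0]; linear_combination hl2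
  rw [e1, e2]
  have h2 : wronskian ((P.phi lam).right P.b) ((P.phi mu).right P.b) =
      (lam - mu) * P.d₂ / (k * l) := by
    rw [eq_div_iff (mul_ne_zero hk hl0)]; linear_combination h1
  rw [h2] at h
  refine mul_left_cancel₀ hsub ?_
  rw [← h]
  field_simp
  ring

/-- Bessel's inequality. -/
theorem sum_inv_normConst_le (s : Finset ℂ) (hs : ∀ lam ∈ s, P.charFun lam = 0) {m : ℂ → ℝ}
    (hm : ∀ lam ∈ s, 0 < m lam ∧ P.normConst lam = m lam) :
    ∑ lam ∈ s, (m lam)⁻¹ ≤ P.d₁⁻¹ := by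
  have him : ∀ lam ∈ s, lam.im = 0 := fun lam h => im_eq_zero_of_charFun_eq_zero (hs lam h)
  -- Up to the factor `d₁`, these are the Fourier coefficients of the vector supported in the
  -- component of the boundary condition at `a`.
  set c : ℂ → ℂ := fun lam => ((m lam)⁻¹ : ℝ) with hc
  set Y := PiecewiseFun.sum s c P.phi with hY
  have hphi : ∀ lam ∈ s, P.PiecewiseContinuous (P.phi lam) := fun lam _ =>
    (P.isSol_phi lam).continuousOn
  have hYc : P.PiecewiseContinuous Y := .sum hphi
  have hYreal : P.Agree Y.conj Y := by
    have aux : ∀ (u : ℂ → ℂ × ℂ), (∀ lam ∈ s, star (u lam) = u lam) →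
        star (∑ lam ∈ s, c lam • u lam) = ∑ lam ∈ s, c lam • u lam := fun u hu => by
      rw [star_sum]
      refine Finset.sum_congr rfl fun lam hl => ?_
      rw [star_smul, hu lam hl, hc, Complex.star_def, Complex.conj_ofReal]
    exact ⟨fun x hx => aux _ fun lam hl => (P.phi_conj_agree (him lam hl)).1 hx,
      fun x hx => aux _ fun lam hl => (P.phi_conj_agree (him lam hl)).2.1 hx,
      fun x hx => aux _ fun lam hl => (P.phi_conj_agree (him lam hl)).2.2 hx⟩
  obtain ⟨r, hr, hr0, -⟩ := P.exists_form_conj Y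
  rw [form_congr ⟨fun _ _ => rfl, fun _ _ => rfl, fun _ _ => rfl⟩ hYreal] at hr
  set S := ∑ lam ∈ s, (m lam)⁻¹ with hS
  set T := ∑ lam ∈ s, (m lam)⁻¹ * (P.endNum lam).re with hT
  have hend : ∀ lam ∈ s, P.endNum lam = ((P.endNum lam).re : ℂ) := fun lam hl =>
    Complex.ext (by simp) (by simp [endNum_im (him lam hl)])
  -- The diagonal term follows the off-diagonal formula up to an extra `1`, because `c mu` times the
  -- normalizing constant is `1`.
  have hcoef : ∀ lam ∈ s, P.form (P.phi lam) Y =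
      ((1 - (P.d₁ * S + P.d₂⁻¹ * ((P.endNum lam).re * T)) : ℝ) : ℂ) := by
    intro lam hl
    have h1 : ∀ mu ∈ s, c mu * P.form (P.phi mu) (P.phi lam) =
        (if mu = lam then 1 else 0) -
          c mu * (P.d₁ + (P.d₂ : ℂ)⁻¹ * (P.endNum lam * P.endNum mu)) := by
      intro mu hmu
      by_cases hml : mu = lam
      · subst hml
        have h2 := P.normConst_eq mu
        rw [(hm mu hmu).2] at h2
        have h3 : c mu * m mu = 1 := by
          simp only [hc]
          rw [← Complex.ofReal_mul, inv_mul_cancel₀ (hm mu hmu).1.ne', Complex.ofReal_one]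
        rw [if_pos rfl]
        linear_combination h3 - c mu * h2
      · rw [if_neg hml, form_phi_phi (hs mu hmu) (hs lam hl) hml]
        ring
    rw [form_comm, hY, form_sum hphi (hphi lam hl), Finset.sum_congr rfl h1,
      Finset.sum_sub_distrib, Finset.sum_ite_eq' s lam, if_pos hl]
    have h2 : ∑ mu ∈ s, c mu * (P.d₁ + (P.d₂ : ℂ)⁻¹ * (P.endNum lam * P.endNum mu)) =
        ∑ mu ∈ s, (P.d₁ * c mu + (P.d₂ : ℂ)⁻¹ * ((P.endNum lam).re *
          (c mu * (P.endNum mu).re))) :=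
      Finset.sum_congr rfl fun mu hmu => by
        rw [hend lam hl, hend mu hmu]
        simp only [Complex.ofReal_re]
        ring
    rw [h2, Finset.sum_add_distrib, ← Finset.mul_sum, ← Finset.mul_sum, ← Finset.mul_sum, hS, hT]
    simp only [hc]
    push_cast
    ring
  -- Since `r ≥ 0`, this yields `d₁ S² ≤ S`, which is the claim.
  have hfinal : r = S - P.d₁ * S ^ 2 - P.d₂⁻¹ * T ^ 2 := by
    have h1 : (r : ℂ) = ((S - P.d₁ * S ^ 2 - P.d₂⁻¹ * T ^ 2 : ℝ) : ℂ) := by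
      rw [← hr]
      conv_lhs => rw [hY]
      rw [form_sum hphi hYc, Finset.sum_congr rfl fun lam hl => by rw [hcoef lam hl]]
      simp only [hc, ← Complex.ofReal_mul, ← Complex.ofReal_sum]
      congr 1
      have h3 : ∀ lam ∈ s, (m lam)⁻¹ * (1 - (P.d₁ * S + P.d₂⁻¹ * ((P.endNum lam).re * T))) =
          (1 - P.d₁ * S) * (m lam)⁻¹ - P.d₂⁻¹ * T * ((m lam)⁻¹ * (P.endNum lam).re) :=
        fun lam _ => by ring
      rw [Finset.sum_congr rfl h3, Finset.sum_sub_distrib, ← Finset.mul_sum, ← Finset.mul_sum]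
      ring
    exact_mod_cast h1
  have hd1 := P.d₁_pos'
  have hT0 : 0 ≤ P.d₂⁻¹ * T ^ 2 := mul_nonneg (inv_pos.2 P.d₂_pos').le (sq_nonneg _)
  have h1 : P.d₁ * S ^ 2 ≤ S := by linarith
  have hS0 : 0 ≤ S := Finset.sum_nonneg fun lam hl => (inv_pos.2 (hm lam hl).1).le
  rcases hS0.eq_or_lt with h0 | h0
  · rw [← h0]; exact (inv_pos.2 hd1).le
  · rw [← one_div, le_div_iff₀ hd1]
    nlinarith

/-! ### The derivative of `Δ` at an eigenvalue -/

theorem continuous_form_phi (mu : ℂ) : Continuous fun lam => P.form (P.phi lam) (P.phi mu) := by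
  have h0 : (fun lam => P.form (P.phi lam) (P.phi mu)) =
      fun lam => P.form (P.sol lam (P.phiInit lam)) (P.sol mu (P.phiInit mu)) :=
    funext fun lam => form_congr (P.phi_agree lam) (P.phi_agree mu)
  rw [h0]
  obtain ⟨c1, c2, c3⟩ := continuous_sol (P := P) differentiable_phiInit
  have aux : ∀ {y : ℂ → ℝ → ℂ × ℂ}, Continuous (fun p : ℂ × ℝ => y p.1 p.2) → ∀ c d : ℝ,
      Continuous fun lam => ∫ x in c..d, ((y lam x).1 * (y mu x).1 + (y lam x).2 * (y mu x).2) := by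
    intro y hy c d
    refine intervalIntegral.continuous_parametric_intervalIntegral_of_continuous' ?_ c d
    have hmu : Continuous fun p : ℂ × ℝ => y mu p.2 :=
      hy.comp (continuous_const.prodMk continuous_snd)
    exact (hy.fst.mul hmu.fst).add (hy.snd.mul hmu.snd)
  have e1 : Continuous fun lam => (P.sol lam (P.phiInit lam)).left P.ξ₁ :=
    c1.comp (continuous_id.prodMk continuous_const)
  have e2 : Continuous fun lam => (P.sol lam (P.phiInit lam)).mid P.ξ₂ :=
    c2.comp (continuous_id.prodMk continuous_const)
  unfold form
  exact ((((continuous_const.mul (aux c1 _ _)).add (continuous_const.mul (aux c2 _ _))).add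
    (continuous_const.mul (aux c3 _ _))).add
    (continuous_const.mul (e1.fst.mul continuous_const))).add
    (continuous_const.mul (e2.fst.mul continuous_const))

theorem form_lincomb_zero (y z : PiecewiseFun) (k : ℂ) :
    P.form y (PiecewiseFun.lincomb k z 0 z) = k * P.form y z := by
  have h : ∀ (u v : ℝ → ℂ × ℂ) (c d : ℝ),
      ∫ x in c..d, ((u x).1 * (k • v x + (0 : ℂ) • v x).1 +
        (u x).2 * (k • v x + (0 : ℂ) • v x).2) =
      k * ∫ x in c..d, ((u x).1 * (v x).1 + (u x).2 * (v x).2) := fun u v c d => by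
    rw [← intervalIntegral.integral_const_mul]
    refine intervalIntegral.integral_congr fun x _ => ?_
    simp only [zero_smul, add_zero, Prod.smul_fst, Prod.smul_snd, smul_eq_mul]
    ring
  simp only [form, PiecewiseFun.lincomb, h]
  simp only [zero_smul, add_zero, Prod.smul_fst, smul_eq_mul]
  ring

/-- The derivative of the characteristic function at an eigenvalue, and the corresponding residue
of the Weyl function. -/
theorem exists_deriv_charFun {mu : ℂ} (h : P.charFun mu = 0) :
    ∃ k : ℂ, k ≠ 0 ∧ P.weylNum mu = k * P.d₁ ∧ deriv P.charFun mu = -(k * P.normConst mu) := by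
  obtain ⟨k, hk, hag⟩ := exists_psi_agree_smul_phi h
  have ha : (P.psi mu).left P.a = k • P.phiInit mu := by
    rw [hag.1 left_mem_left, ← phi_left_a]; simp [PiecewiseFun.lincomb]
  have hb : P.psiEnd mu = k • (P.phi mu).right P.b := by
    rw [← psi_right_b, hag.2.2 right_mem_right]; simp [PiecewiseFun.lincomb]
  refine ⟨k, hk, ?_, ?_⟩
  · rw [weylNum, ha, d₁_eq]
    simp only [phiInit, Prod.smul_fst, Prod.smul_snd, smul_eq_mul]
    ring
  -- Lagrange's identity for `φ(·, lam)` and `ψ(·, mu)` splits the factor `mu - lam` off `Δ`; the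
  -- term `endNum` accounts for replacing `psiEnd mu` by `psiEnd lam`. Continuity of `g` then
  -- suffices for the derivative at `mu`.
  set g : ℂ → ℂ := fun lam =>
    k * P.d₁ + k * P.form (P.phi lam) (P.phi mu) - P.endNum lam with hg
  have hfac : ∀ lam, P.charFun lam = (mu - lam) * g lam := by
    intro lam
    have h1 := (P.isSol_phi lam).wronskian_sub (P.isSol_psi mu)
    rw [phi_left_a, psi_right_b, ha, wronskian_smul_right, wronskian_phiInit,
      form_congr ⟨fun _ _ => rfl, fun _ _ => rfl, fun _ _ => rfl⟩ hag, form_lincomb_zero] at h1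
    rw [charFun_eq]
    simp only [hg, endNum, wronskian, psiEnd] at h1 ⊢
    linear_combination h1
  have hgc : Continuous g := by
    have h1 := P.differentiable_phi_right_b.continuous
    exact (continuous_const.add (continuous_const.mul (continuous_form_phi mu))).sub
      ((continuous_const.mul h1.fst).sub (continuous_const.mul h1.snd))
  have hder : HasDerivAt P.charFun (-g mu) mu := by
    rw [hasDerivAt_iff_tendsto_slope]
    refine ((hgc.neg.tendsto mu).mono_left nhdsWithin_le_nhds).congr' ?_
    filter_upwards [self_mem_nhdsWithin] with lam hlam
    have : lam - mu ≠ 0 := sub_ne_zero.2 hlam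
    rw [slope_def_field, h, hfac lam, Pi.neg_apply]
    field_simp
    ring
  have hend : k * P.endNum mu = -P.d₂ := by
    have e1 := congrArg Prod.fst hb
    have e2 := congrArg Prod.snd hb
    simp only [psiEnd, Prod.smul_fst, Prod.smul_snd, smul_eq_mul] at e1 e2
    rw [endNum, d₂_eq]
    linear_combination (P.γ₂' : ℂ) * e2 - P.γ₁' * e1
  rw [hder.deriv, normConst_eq]
  simp only [hg]
  have hd := P.d₂_ne
  field_simp
  linear_combination P.endNum mu * hend

end DiracProblem

/-! ### The expansion of the Weyl function -/

theorem lemma6 (P : DiracProblem) :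
    (∃ ev : ℤ → ℂ, P.IsEnumeration ev) ∧
    ∀ ev : ℤ → ℂ, P.IsEnumeration ev →
      (∀ n : ℤ, P.normConst (ev n) ≠ 0) ∧
      ∀ lam : ℂ, lam ∉ P.eigenvalues →
        P.charFun lam ≠ 0 ∧
        HasSum (fun n : ℤ => 1 / (P.normConst (ev n) * (ev n - lam))) (P.weylFun lam) := by
  have hset : P.eigenvalues = {z | P.charFun z = 0} :=
    Set.ext fun z => DiracProblem.mem_eigenvalues_iff
  have hreal : ∀ z, P.charFun z = 0 → z.im = 0 := fun z hz =>
    DiracProblem.im_eq_zero_of_charFun_eq_zero hz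
  choose m hm using fun z : P.eigenvalues =>
    P.exists_normConst_eq (hreal z (DiracProblem.mem_eigenvalues_iff.1 z.2))
  have hne : ∀ z, P.charFun z = 0 → P.normConst z ≠ 0 := fun z hz => by
    obtain ⟨r, hr, h⟩ := P.exists_normConst_eq (hreal z hz)
    rw [h]; exact_mod_cast hr.ne'
  have hsimple : ∀ z, P.charFun z = 0 → deriv P.charFun z ≠ 0 := fun z hz => by
    obtain ⟨k, hk, -, h⟩ := DiracProblem.exists_deriv_charFun hz
    rw [h]; exact neg_ne_zero.2 (mul_ne_zero hk (hne z hz))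
  have hsumm : Summable fun z : P.eigenvalues => (m z)⁻¹ := by
    refine summable_of_sum_le (c := P.d₁⁻¹) (fun z => (inv_pos.2 (hm z).1).le) fun s => ?_
    have hmem : ∀ lam ∈ s.map (Function.Embedding.subtype _), lam ∈ P.eigenvalues := fun lam hl => by
      obtain ⟨z, -, rfl⟩ := Finset.mem_map.1 hl; exact z.2
    have h1 := P.sum_inv_normConst_le (s.map (Function.Embedding.subtype _))
      (m := fun lam => (P.normConst lam).re)
      (fun lam hl => DiracProblem.mem_eigenvalues_iff.1 (hmem lam hl))
      (fun lam hl => by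
        have := hm ⟨lam, hmem lam hl⟩
        simp only [this.2, Complex.ofReal_re, this.1, true_and])
    rw [Finset.sum_map] at h1
    refine le_trans (le_of_eq (Finset.sum_congr rfl fun z _ => ?_)) h1
    simp [(hm z).2]
  -- A summable family has countable support, and here no term vanishes.
  have hcount : P.eigenvalues.Countable := by
    have h1 := hsumm.countable_support
    have h2 : Function.support (fun z : P.eigenvalues => (m z)⁻¹) = univ :=
      eq_univ_of_forall fun z => (inv_pos.2 (hm z).1).ne'
    rw [h2] at h1
    exact Set.countable_coe_iff.1 (Set.countable_univ_iff.1 h1)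
  have hinf : P.eigenvalues.Infinite := by
    rw [hset]
    exact infinite_zeros_of_exp_growth P.differentiable_charFun hreal hsimple
      P.abs_im_le_charFun
      (Real.sqrt_pos.2 (mul_pos P.d₁_pos' P.d₂_pos'))
      (mul_pos P.ρ₃_pos (sub_pos.2 P.lt_b)) fun τ hτ => P.exp_le_charFun hτ
  refine ⟨?_, fun ev hev => ⟨fun n => ?_, fun lam hlam => ?_⟩⟩
  · have := hcount.to_subtype
    have := hinf.to_subtype
    obtain ⟨e⟩ : Nonempty (ℤ ≃ P.eigenvalues) := nonempty_equiv_of_countable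
    exact ⟨fun n => e n, Subtype.val_injective.comp e.injective, by
      rw [Set.range_comp' Subtype.val e, e.surjective.range_eq, image_univ, Subtype.range_coe]⟩
  · exact hne _ (DiracProblem.mem_eigenvalues_iff.1 (hev.2 ▸ mem_range_self n))
  · have hD : P.charFun lam ≠ 0 := fun h => hlam (DiracProblem.mem_eigenvalues_iff.2 h)
    refine ⟨hD, ?_⟩
    have hz : ∀ n, P.charFun (ev n) = 0 := fun n =>
      DiracProblem.mem_eigenvalues_iff.1 (hev.2 ▸ mem_range_self n)
    -- The factor `k` relating `ψ` to `φ` cancels in the residue.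
    have hres : ∀ n, P.weylNum (ev n) / P.d₁ / deriv P.charFun (ev n) =
        -(P.normConst (ev n))⁻¹ := fun n => by
      obtain ⟨k, hk, h1, h2⟩ := DiracProblem.exists_deriv_charFun (hz n)
      have := hne _ (hz n)
      have := P.d₁_ne
      rw [h1, h2]
      field_simp
    have hs : Summable fun n => ‖P.weylNum (ev n) / P.d₁ / deriv P.charFun (ev n)‖ := by
      have h1 : Function.Injective fun n => (⟨ev n, hev.2 ▸ mem_range_self n⟩ : P.eigenvalues) :=
        fun i j h => hev.1 (congrArg Subtype.val h)
      refine (hsumm.comp_injective h1).congr fun n => ?_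
      rw [hres, norm_neg, norm_inv, (hm ⟨ev n, hev.2 ▸ mem_range_self n⟩).2, Complex.norm_real,
        Real.norm_of_nonneg (hm _).1.le]
      rfl
    have h := hasSum_partialFraction (C := P.d₁⁻¹) (P.differentiable_weylNum.div_const (P.d₁ : ℂ))
      P.differentiable_charFun hev.1 (fun n => hreal _ (hz n))
      (fun z => by rw [hev.2, DiracProblem.mem_eigenvalues_iff])
      (fun n => hsimple _ (hz n)) hs
      (fun z => by
        rw [norm_div, Complex.norm_real, Real.norm_of_nonneg P.d₁_pos'.le, div_mul_eq_mul_div,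
          inv_mul_eq_div]
        exact div_le_div_of_nonneg_right (P.norm_weylNum_mul_abs_im_le z) P.d₁_pos'.le) hD
    rw [P.weylFun_eq]
    refine h.congr_fun fun n => ?_
    rw [hres, neg_neg, one_div, mul_inv, div_eq_mul_inv]
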